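/- **Setting.** A school matching instance $I=(A,B,\succ,q)$ consists of finite sets $A$ of students and $B$ of schools (here called classes), for every $a\in A$ a strict total order $\succ_a$ on $B\cup\{\emptyset\}$, for every $b\in B$ a strict total order $\succ_b$ on $A\cup\{\emptyset\}$ (where $\emptyset$ is the outside option), and quotas $q_b\le |A|$. A matching $M$ assigns to every student $a$ a partner $M(a)\in B\cup\{\emptyset\}$ so that every class $b$ receives at most $q_b$ students; $M(b)$ is the set of students assigned to $b$, together with $\emptyset$ if there are fewer than $q_b$ of them. $M$ is stable if there is no pair $ab\in A\times B$ with $b\succ_a M(a)$ and $a\succ_b a'$ for some $a'\in M(b)$, no student $a$ with $\emptyset\succ_a M(a)$, and no class $b$ with $\emptyset\succ_b a$ for some student $a\in M(b)$. A student $a$ is eligible for a class $b$ if $b\succ_a\emptyset$. An instance of (MSSP) consists of a school matching instance $(A,B,\succ,q)$, a set $\mathcal C\subseteq A\times A$ of pairs of distinct students (siblings), and a partition of $B$ into nonempty parts (activities), such that 1. every student is eligible for at most one class of each activity; 2. siblings rank activities in the same order: if $(a,\bar a)\in\mathcal C$, $c,c'$ are activities, $a$ is eligible for $b\in c$ and $b'\in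 c'$, and $\bar a$ is eligible for $\bar b\in c$ and $\bar b'\in c'$, then $b\succ_a b'$ if and only if $\bar b\succ_{\bar a}\bar b'$. The question is whether there exists an activity-stable matching, that is, a stable matching $M$ such that for every $(a,\bar a)\in\mathcal C$ both $M(a)$ and $M(\bar a)$ are classes and belong to the same activity. **Theorem.** (MSSP) can be solved in polynomial time: there are an algorithm and a polynomial $p$ such that on every instance of (MSSP), given explicitly by its preference rankings, quotas, activities and sibling pairs in an encoding of $N$ bits, the algorithm halts after at most $p(N)$ steps and answers correctly whether an activity-stable matching exists. -/

import Mathlib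

/-! ### A random access machine with a step count

Programs of a small imperative language over finitely many unbounded arrays of natural numbers
(a scalar variable is an array of which only the cell `0` is used). Every operation costs one step.
The only arithmetic is addition and truncated subtraction, so each step lengthens the binary
representation of the largest number in use by at most one bit (beyond the constants of the
program); hence polynomial time on this machine is the same as polynomial time on a Turing
machine. -/

namespace RAM

/-- The contents of the memory: `s x i` is the value of cell `i` of the array with name `x`. -/
abbrev Store := ℕ → ℕ → ℕ

/-- Arithmetic expressions. The names of arrays are constants of the program, the index of a cell
is computed. -/
inductive Expr : Type
  | num (n : ℕ)
  | read (x : ℕ) (i : Expr)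
  | add (e f : Expr)
  | sub (e f : Expr)

/-- The value of an expression. -/
def Expr.value (s : Store) : Expr → ℕ
  | .num n => n
  | .read x i => s x (i.value s)
  | .add e f => e.value s + f.value s
  | .sub e f => e.value s - f.value s

/-- The number of steps taken to evaluate an expression: one for each operation in it. -/
def Expr.cost : Expr → ℕ
  | .num _ => 1
  | .read _ i => i.cost + 1
  | .add e f => e.cost + f.cost + 1
  | .sub e f => e.cost + f.cost + 1

/-- Programs. A test succeeds when the value of the expression is not `0`. -/
inductive Program : Type
  | skip
  | write (x : ℕ) (i e : Expr)
  | seq (c d : Program)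
  | cond (e : Expr) (c d : Program)
  | loop (e : Expr) (c : Program)

/-- `Exec c s t s'`: started in the store `s`, the program `c` halts after exactly `t` steps in
the store `s'`. -/
inductive Exec : Program → Store → ℕ → Store → Prop
  | skip (s : Store) : Exec .skip s 1 s
  | write (s : Store) (x : ℕ) (i e : Expr) :
      Exec (.write x i e) s (i.cost + e.cost + 1)
        (Function.update s x (Function.update (s x) (i.value s) (e.value s)))
  | seq {c d : Program} {s s' s'' : Store} {t t' : ℕ} :
      Exec c s t s' → Exec d s' t' s'' → Exec (.seq c d) s (t + t') s''
  | condTrue {e : Expr} {c d : Program} {s s' : Store} {t : ℕ} :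
      e.value s ≠ 0 → Exec c s t s' → Exec (.cond e c d) s (e.cost + 1 + t) s'
  | condFalse {e : Expr} {c d : Program} {s s' : Store} {t : ℕ} :
      e.value s = 0 → Exec d s t s' → Exec (.cond e c d) s (e.cost + 1 + t) s'
  | loopTrue {e : Expr} {c : Program} {s s' s'' : Store} {t t' : ℕ} :
      e.value s ≠ 0 → Exec c s t s' → Exec (.loop e c) s' t' s'' →
        Exec (.loop e c) s (e.cost + 1 + t + t') s''
  | loopFalse {e : Expr} {c : Program} {s : Store} :
      e.value s = 0 → Exec (.loop e c) s (e.cost + 1) s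

/-- The initial store on the input `w`: array `0` holds `w`, cell `0` of array `1` holds the number
of entries of `w`, and everything else is `0`. -/
def input (w : List ℕ) : Store := fun x i =>
  if x = 0 then w.getD i 0 else if x = 1 ∧ i = 0 then w.length else 0

/-- The answer of the machine, read from cell `0` of array `2`. -/
def output (s : Store) : ℕ := s 2 0

/-- The number of bits needed to write down `w`, one separator included for each entry. -/
def bitSize (w : List ℕ) : ℕ := (w.map fun n => n.size + 1).sum

/-- The decision problem with instances `x : α`, presented to the machine as `enc x`, and question
`P x`, can be solved in polynomial time: a single program halts on every instance after a number of
steps that is at most a fixed polynomial of the length of the input, with output `1` if the answer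
is yes and with output `0` if it is no. -/
def SolvableInPolyTime {α : Type} (enc : α → List ℕ) (P : α → Prop) : Prop :=
  ∃ (c : Program) (p : Polynomial ℕ), ∀ x : α, ∃ (t : ℕ) (s : Store),
    Exec c (input (enc x)) t s ∧ t ≤ p.eval (bitSize (enc x)) ∧
      (P x → output s = 1) ∧ (¬ P x → output s = 0)

end RAM

/-! ### Stable matchings with quotas -/

/-- A school matching instance with students `Fin nA`, schools `Fin nB` and the outside option
`none`. The strict order of an agent over the `n` options it has is given by the bijection that
sends an option to its rank in `{0, …, n - 1}`, where `0` is the rank of the favourite. -/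
structure SchoolInstance where
  nA : ℕ
  nB : ℕ
  studentRank : Fin nA → Option (Fin nB) ≃ Fin (nB + 1)
  schoolRank : Fin nB → Option (Fin nA) ≃ Fin (nA + 1)
  quota : Fin nB → ℕ
  quota_le : ∀ b, quota b ≤ nA

namespace SchoolInstance

variable (I : SchoolInstance)

/-- Student `a` strictly prefers `x` to `y`. -/
def StudentPrefers (a : Fin I.nA) (x y : Option (Fin I.nB)) : Prop :=
  I.studentRank a x < I.studentRank a y

/-- School `b` strictly prefers `x` to `y`. -/
def SchoolPrefers (b : Fin I.nB) (x y : Option (Fin I.nA)) : Prop :=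
  I.schoolRank b x < I.schoolRank b y

/-- The students that are assigned to the school `b`. -/
def assigned (M : Fin I.nA → Option (Fin I.nB)) (b : Fin I.nB) : Finset (Fin I.nA) :=
  Finset.univ.filter fun a => M a = some b

/-- A matching is given by the partner of every student, a school or the outside option, where no
school exceeds its quota. -/
def IsMatching (M : Fin I.nA → Option (Fin I.nB)) : Prop :=
  ∀ b, (I.assigned M b).card ≤ I.quota b

/-- The partners of the school `b`: the students assigned to it and, if it has a free seat, the
outside option. -/
def partners (M : Fin I.nA → Option (Fin I.nB)) (b : Fin I.nB) : Set (Option (Fin I.nA)) :=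
  {x | (∃ a ∈ I.assigned M b, x = some a) ∨ (x = none ∧ (I.assigned M b).card < I.quota b)}

/-- `ab` is a blocking pair. -/
def BlockingPair (M : Fin I.nA → Option (Fin I.nB)) (a : Fin I.nA) (b : Fin I.nB) : Prop :=
  I.StudentPrefers a (some b) (M a) ∧ ∃ x ∈ I.partners M b, I.SchoolPrefers b (some a) x

/-- The student `a` is a blocking agent. -/
def BlockingStudent (M : Fin I.nA → Option (Fin I.nB)) (a : Fin I.nA) : Prop :=
  I.StudentPrefers a none (M a)

/-- The school `b` is a blocking agent. -/
def BlockingSchool (M : Fin I.nA → Option (Fin I.nB)) (b : Fin I.nB) : Prop :=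
  ∃ a ∈ I.assigned M b, I.SchoolPrefers b none (some a)

/-- Stable matchings. -/
def IsStable (M : Fin I.nA → Option (Fin I.nB)) : Prop :=
  I.IsMatching M ∧ (∀ a b, ¬ I.BlockingPair M a b) ∧ (∀ a, ¬ I.BlockingStudent M a) ∧
    ∀ b, ¬ I.BlockingSchool M b

/-- The student `a` is eligible for the class `b`: it prefers `b` to the outside option. -/
def Eligible (a : Fin I.nA) (b : Fin I.nB) : Prop :=
  I.StudentPrefers a (some b) none

end SchoolInstance

/-! ### Matching siblings to the same activity -/

/-- An instance of (MSSP). The schools are called classes; they are partitioned into `k` nonempty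
activities, each student is eligible for at most one class of each activity, and siblings rank the
activities in the same order. -/
structure MSSPInstance extends SchoolInstance where
  siblings : Finset (Fin nA × Fin nA)
  siblings_ne : ∀ p ∈ siblings, p.1 ≠ p.2
  k : ℕ
  activity : Fin nB → Fin k
  activity_surjective : Function.Surjective activity
  eligible_unique : ∀ a b b', toSchoolInstance.Eligible a b → toSchoolInstance.Eligible a b' →
    activity b = activity b' → b = b'
  same_order : ∀ p ∈ siblings, ∀ b₁ b₂ b₁' b₂' : Fin nB,
    toSchoolInstance.Eligible p.1 b₁ → toSchoolInstance.Eligible p.1 b₂ →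
    toSchoolInstance.Eligible p.2 b₁' → toSchoolInstance.Eligible p.2 b₂' →
    activity b₁ = activity b₁' → activity b₂ = activity b₂' →
      (toSchoolInstance.StudentPrefers p.1 (some b₁) (some b₂) ↔
        toSchoolInstance.StudentPrefers p.2 (some b₁') (some b₂'))

namespace MSSPInstance

variable (I : MSSPInstance)

/-- `M` is an activity-stable matching: it is stable, and both members of each pair of siblings are
assigned to classes, of the same activity. -/
def IsActivityStable (M : Fin I.nA → Option (Fin I.nB)) : Prop :=
  I.IsStable M ∧ ∀ p ∈ I.siblings, ∃ b b' : Fin I.nB,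
    M p.1 = some b ∧ M p.2 = some b' ∧ I.activity b = I.activity b'

/-- The instance as a sequence of numbers: the numbers of students, classes and activities, the
ranks given by each student to the outside option and to the classes, the ranks given by each class
to the outside option and to the students, the quotas, the activities of the classes, and the
incidence matrix of the set of pairs of siblings. -/
def encode : List ℕ :=
  [I.nA, I.nB, I.k]
    ++ (List.finRange I.nA).flatMap (fun a =>
        (none :: (List.finRange I.nB).map some).map fun x => (I.studentRank a x : ℕ))
    ++ (List.finRange I.nB).flatMap (fun b =>
        (none :: (List.finRange I.nA).map some).map fun x => (I.schoolRank b x : ℕ))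
    ++ (List.finRange I.nB).map I.quota
    ++ (List.finRange I.nB).map (fun b => (I.activity b : ℕ))
    ++ (List.finRange I.nA).flatMap (fun a =>
        (List.finRange I.nA).map fun a' => if (a, a') ∈ I.siblings then 1 else 0)

end MSSPInstance

/-! The algorithm is deferred acceptance, phrased with lower bounds. `R a` bounds from below the
rank that the student `a` gives to its partner in every activity-stable matching; at the start `R =
0`. If the option of rank `R a` is a class that cannot be given to `a` under these bounds
(`Rejects`), then `R a` grows by one, and `LowerBound.advance` keeps the bound valid. Two reasons
for a rejection are specific to siblings. One is that a sibling has no eligible class of the same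
activity left. The other is that the class prefers a student that has already left it: such a
student may have left on account of a sibling, so the class need not be full.

At a fixed point, give every student the option of rank `R a`. If `Accepting R` holds, this matching
is activity-stable (`Accepting.exists_isActivityStable`). Indeed, if siblings were in different
activities, each would have a class of the other's activity that it ranks below its own class,
against the common order of the activities. Conversely, if some activity-stable `M` exists, then
`Accepting R` holds (`LowerBound.accepting`), by a count in the style of the rural hospitals
theorem. Every class has at most as many students under `R` as under `M`, and every student matched
by `M` is matched under `R`, so the numbers agree class by class. A class left by an acceptable
student is full in `M`, hence full under `R`.

The sum of the bounds is at most `nA * (nB + 1)`, which is less than the length of the input, and a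
round over all students either raises the sum or exhibits a fixed point (`Progress`). Hence as many
rounds as the input has entries suffice. The tests `CanAdvance` and `Accepting` are formulas with
counting quantifiers over students and classes; `Formula.triple_compile` turns every such formula
into a program of polynomial running time. -/

/-! ### Time-bounded Hoare triples -/

namespace RAM

/-- The store obtained by writing `n` to cell `i` of the array `x`. -/
def Store.put (s : Store) (x i n : ℕ) : Store :=
  Function.update s x (Function.update (s x) i n)

theorem Store.put_of_ne (s : Store) {x y : ℕ} (i n : ℕ) (h : y ≠ x) : s.put x i n y = s y := by
  simp [Store.put, h]

theorem Store.put_same (s : Store) (x i n : ℕ) :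
    s.put x i n x = Function.update (s x) i n := by
  simp [Store.put]

theorem Store.put_put (s : Store) (x i n m : ℕ) : (s.put x i n).put x i m = s.put x i m := by
  simp [Store.put]

theorem Store.put_self (s : Store) (x i : ℕ) : s.put x i (s x i) = s := by
  simp [Store.put]

/-- Started in a store with the property `P`, the program `c` halts within `T` steps in a store
with the property `Q`. -/
def Triple (P : Store → Prop) (c : Program) (T : ℕ) (Q : Store → Prop) : Prop :=
  ∀ s, P s → ∃ t s', Exec c s t s' ∧ t ≤ T ∧ Q s'

theorem Triple.conseq {P P' Q Q' : Store → Prop} {c : Program} {T T' : ℕ} (h : Triple P c T Q)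
    (hP : ∀ s, P' s → P s) (hT : T ≤ T') (hQ : ∀ s, Q s → Q' s) : Triple P' c T' Q' := by
  intro s hs
  obtain ⟨t, s', h1, h2, h3⟩ := h s (hP s hs)
  exact ⟨t, s', h1, h2.trans hT, hQ _ h3⟩

/-- Fixing the initial store allows the later assertions to refer to it. -/
theorem Triple.pointwise {P Q : Store → Prop} {c : Program} {T : ℕ}
    (h : ∀ s₀, P s₀ → Triple (fun s => s = s₀) c T Q) : Triple P c T Q :=
  fun s hs => h s hs s rfl

theorem Triple.seq {P Q R : Store → Prop} {c d : Program} {T T' : ℕ} (h : Triple P c T Q)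
    (h' : Triple Q d T' R) : Triple P (.seq c d) (T + T') R := by
  intro s hs
  obtain ⟨t, s', h1, h2, h3⟩ := h s hs
  obtain ⟨t', s'', h1', h2', h3'⟩ := h' s' h3
  exact ⟨_, s'', .seq h1 h1', by omega, h3'⟩

theorem Triple.skip (P : Store → Prop) : Triple P .skip 1 P :=
  fun s hs => ⟨_, s, .skip s, le_rfl, hs⟩

theorem Triple.write {P Q : Store → Prop} (x : ℕ) (i e : Expr)
    (h : ∀ s, P s → Q (s.put x (i.value s) (e.value s))) :
    Triple P (.write x i e) (i.cost + e.cost + 1) Q :=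
  fun s hs => ⟨_, _, .write s x i e, le_rfl, h s hs⟩

theorem Triple.cond {P Q : Store → Prop} {e : Expr} {c d : Program} {T T' : ℕ}
    (h : Triple (fun s => P s ∧ e.value s ≠ 0) c T Q)
    (h' : Triple (fun s => P s ∧ e.value s = 0) d T' Q) :
    Triple P (.cond e c d) (e.cost + 1 + (T + T')) Q := by
  intro s hs
  by_cases he : e.value s = 0
  · obtain ⟨t, s', h1, h2, h3⟩ := h' s ⟨hs, he⟩
    exact ⟨_, s', .condFalse he h1, by omega, h3⟩
  · obtain ⟨t, s', h1, h2, h3⟩ := h s ⟨hs, he⟩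
    exact ⟨_, s', .condTrue he h1, by omega, h3⟩

/-- The program that runs `c` for the values `0, …, b - 1` of the variable `v`. -/
def forLoop (v : ℕ) (b : Expr) (c : Program) : Program :=
  .seq (.write v (.num 0) (.num 0))
    (.loop (.sub b (.read v (.num 0)))
      (.seq c (.write v (.num 0) (.add (.read v (.num 0)) (.num 1)))))

theorem Triple.forLoop {inv : ℕ → Store → Prop} {v n N T : ℕ} {b : Expr} {c : Program}
    (hn : n ≤ N) (hb : ∀ i s, inv i s → b.value s = n) (hv : ∀ i s, inv i s → s v 0 = i)
    (hc : ∀ i < n, Triple (inv i) c T (fun s => s v 0 = i ∧ inv (i + 1) (s.put v 0 (i + 1)))) :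
    Triple (fun s => inv 0 (s.put v 0 0)) (forLoop v b c)
      ((N + 1) * (T + b.cost + 10) + 3) (inv n) := by
  -- `m` counts the remaining passes. A pass costs at most `T + b.cost + 10`, test and increment
  -- included; the extra unit in `m + 1` pays for the final failing test.
  have key : ∀ m i, i + m = n → Triple (inv i)
      (.loop (.sub b (.read v (.num 0)))
        (.seq c (.write v (.num 0) (.add (.read v (.num 0)) (.num 1)))))
      ((m + 1) * (T + b.cost + 10)) (inv n) := by
    intro m
    induction m with
    | zero =>
      intro i hi s hs
      have h0 : (Expr.sub b (.read v (.num 0))).value s = 0 := by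
        simp only [Expr.value, hb i s hs, hv i s hs]; omega
      obtain rfl : i = n := by omega
      refine ⟨_, s, .loopFalse h0, ?_, hs⟩
      simp only [Expr.cost]; omega
    | succ m ih =>
      intro i hi s hs
      have h0 : (Expr.sub b (.read v (.num 0))).value s ≠ 0 := by
        simp only [Expr.value, hb i s hs, hv i s hs]; omega
      have hstep : Triple (inv i)
          (.seq c (.write v (.num 0) (.add (.read v (.num 0)) (.num 1)))) (T + 6) (inv (i + 1)) := by
        refine (hc i (by omega)).seq (Triple.write _ _ _ ?_)
        rintro s ⟨h1, h2⟩
        simpa only [Expr.value, h1] using h2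
      obtain ⟨t, s', h1, h2, h3⟩ := hstep s hs
      obtain ⟨t', s'', h1', h2', h3'⟩ := ih (i + 1) (by omega) s' h3
      refine ⟨_, s'', .loopTrue h0 h1 h1', ?_, h3'⟩
      simp only [Expr.cost]
      rw [add_mul (m + 1)]
      omega
  refine (Triple.seq (Triple.write _ _ _ ?_) (key n 0 (by omega))).conseq
    (fun _ h => h) ?_ (fun _ h => h)
  · intro s hs
    simpa only [Expr.value] using hs
  · have : (n + 1) * (T + b.cost + 10) ≤ (N + 1) * (T + b.cost + 10) := by gcongr
    simp only [Expr.cost]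
    omega

/-! ### Formulas with bounded counting quantifiers -/

/-- Formulas over the store. In `atLeast e v j p` the variable `v` runs over the numbers below the
content of cell `j` of the input. -/
inductive Formula : Type
  | lt (e f : Expr)
  | neg (p : Formula)
  | conj (p q : Formula)
  | atLeast (e : Expr) (v j : ℕ) (p : Formula)

/-- The truth value of a formula. -/
def Formula.Holds : Formula → Store → Prop
  | .lt e f, s => e.value s < f.value s
  | .neg p, s => ¬ p.Holds s
  | .conj p q, s => p.Holds s ∧ q.Holds s
  | .atLeast e v j p, s => open Classical in
      e.value s ≤ ((Finset.range (s 0 j)).filter fun i => p.Holds (s.put v 0 i)).card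

/-- All arrays that occur have names below `D`. -/
def Expr.Below (D : ℕ) : Expr → Prop
  | .num _ => True
  | .read x i => x < D ∧ i.Below D
  | .add e f => e.Below D ∧ f.Below D
  | .sub e f => e.Below D ∧ f.Below D

/-- All arrays that occur have names below `D`, no quantifier overwrites the input, and
quantifiers are bounded by the cells `0` and `1` of the input. -/
def Formula.Below (D : ℕ) : Formula → Prop
  | .lt e f => e.Below D ∧ f.Below D
  | .neg p => p.Below D
  | .conj p q => p.Below D ∧ q.Below D
  | .atLeast e v j p => e.Below D ∧ 0 < v ∧ v < D ∧ j < 2 ∧ p.Below D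

/-! ### Dependence of expressions and formulas on low arrays only -/

theorem Expr.Below.mono {D D' : ℕ} (h : D ≤ D') : ∀ {e : Expr}, e.Below D → e.Below D'
  | .num _, _ => trivial
  | .read _ _, he => ⟨he.1.trans_le h, he.2.mono h⟩
  | .add _ _, he => ⟨he.1.mono h, he.2.mono h⟩
  | .sub _ _, he => ⟨he.1.mono h, he.2.mono h⟩

theorem Formula.Below.mono {D D' : ℕ} (h : D ≤ D') : ∀ {p : Formula}, p.Below D → p.Below D'
  | .lt _ _, hp => ⟨hp.1.mono h, hp.2.mono h⟩
  | .neg p, hp => Formula.Below.mono (p := p) h hp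
  | .conj _ _, hp => ⟨hp.1.mono h, hp.2.mono h⟩
  | .atLeast _ _ _ _, hp => ⟨hp.1.mono h, hp.2.1, hp.2.2.1.trans_le h, hp.2.2.2.1,
      hp.2.2.2.2.mono h⟩

/-- The stores agree on the arrays with names below `D`. -/
def Agree (D : ℕ) (s s' : Store) : Prop := ∀ x < D, s x = s' x

theorem Agree.put_right {D : ℕ} {s s' : Store} (h : Agree D s s') (v i n : ℕ) :
    Agree D (s.put v i n) (s'.put v i n) := by
  intro x hx
  by_cases hxv : x = v
  · subst hxv; simp only [Store.put_same, h x hx]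
  · simp only [Store.put_of_ne _ _ _ hxv, h x hx]

theorem Agree.put_left {D x : ℕ} {s s' : Store} (h : Agree D s s') (hx : D ≤ x) (i n : ℕ) :
    Agree D (s.put x i n) s' := by
  intro y hy
  rw [Store.put_of_ne _ _ _ (by omega), h y hy]

theorem Agree.mono {D D' : ℕ} {s s' : Store} (h : Agree D s s') (hD : D' ≤ D) : Agree D' s s' :=
  fun x hx => h x (by omega)

theorem Agree.trans {D : ℕ} {s s' s'' : Store} (h : Agree D s s') (h' : Agree D s' s'') :
    Agree D s s'' :=
  fun x hx => (h x hx).trans (h' x hx)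

theorem Expr.value_congr {D : ℕ} {s s' : Store} (h : Agree D s s') :
    ∀ {e : Expr}, e.Below D → e.value s = e.value s'
  | .num _, _ => rfl
  | .read x i, he => by
    simp only [Expr.value, Expr.value_congr h he.2, h x he.1]
  | .add e f, he => by
    simp only [Expr.value, Expr.value_congr h he.1, Expr.value_congr h he.2]
  | .sub e f, he => by
    simp only [Expr.value, Expr.value_congr h he.1, Expr.value_congr h he.2]

open Classical in
-- This makes scratch arrays from `D` on irrelevant to the truth of a formula. The stores are
-- quantified inside the induction because a quantifier updates both of them.
theorem Formula.holds_congr {D : ℕ} {p : Formula} : ∀ {s s' : Store}, Agree D s s' →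
    p.Below D → (p.Holds s ↔ p.Holds s') := by
  induction p with
  | lt e f =>
    intro s s' h hp
    simp only [Formula.Holds, Expr.value_congr h hp.1, Expr.value_congr h hp.2]
  | neg p ih =>
    intro s s' h hp
    simp only [Formula.Holds, ih h hp]
  | conj p q ihp ihq =>
    intro s s' h hp
    simp only [Formula.Holds, ihp h hp.1, ihq h hp.2]
  | atLeast e v j p ih =>
    intro s s' h hp
    obtain ⟨he, hv, hvD, hj, hp⟩ := hp
    have h1 : ∀ i, p.Holds (s.put v 0 i) ↔ p.Holds (s'.put v 0 i) :=
      fun i => ih (h.put_right v 0 i) hp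
    simp only [Formula.Holds, Expr.value_congr h he, h 0 (by omega)]
    rw [Finset.filter_congr fun i _ => h1 i]

/-! ### Compilation of formulas into programs -/

/-- A program that decides the formula `p`, with the answer in cell `0` of the array `D`. -/
def Formula.compile : Formula → ℕ → Program
  | .lt e f, D => .write D (.num 0) (.sub (.num 1) (.sub (.num 1) (.sub f e)))
  | .neg p, D => .seq (p.compile D) (.write D (.num 0) (.sub (.num 1) (.read D (.num 0))))
  | .conj p q, D => .seq (.seq (p.compile D) (q.compile (D + 1)))
      (.write D (.num 0)
        (.sub (.add (.read D (.num 0)) (.read (D + 1) (.num 0))) (.num 1)))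
  | .atLeast e v j p, D =>
      .seq (.seq (.seq (.seq
        (.write D (.num 0) (.read v (.num 0)))
        (.write (D + 1) (.num 0) (.num 0)))
        (forLoop v (.read 0 (.num j)) (.seq (p.compile (D + 2))
          (.write (D + 1) (.num 0) (.add (.read (D + 1) (.num 0)) (.read (D + 2) (.num 0)))))))
        (.write v (.num 0) (.read D (.num 0))))
        (.write D (.num 0) (.sub (.num 1) (.sub e (.read (D + 1) (.num 0)))))

/-- A bound on the number of steps of `Formula.compile`, as a polynomial in the largest range of a
quantifier. -/
noncomputable def Formula.cost : Formula → Polynomial ℕ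
  | .lt e f => ((e.cost + f.cost + 7 : ℕ) : Polynomial ℕ)
  | .neg p => p.cost + ((6 : ℕ) : Polynomial ℕ)
  | .conj p q => p.cost + q.cost + ((9 : ℕ) : Polynomial ℕ)
  | .atLeast e _ _ p => (Polynomial.X + 1) * (p.cost + ((19 : ℕ) : Polynomial ℕ)) +
      ((e.cost + 30 : ℕ) : Polynomial ℕ)

open Classical in
theorem Formula.triple_compile (p : Formula) : ∀ (D N : ℕ) (s₀ : Store), p.Below D →
    (∀ j < 2, s₀ 0 j ≤ N) → 0 < D →
    Triple (fun s => Agree D s s₀) (p.compile D) (p.cost.eval N)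
      (fun s => Agree D s s₀ ∧ s D 0 = if p.Holds s₀ then 1 else 0) := by
  induction p with
  | lt e f =>
    intro D N s₀ hp hN hD
    refine (Triple.write _ _ _ ?_).conseq (fun _ h => h) ?_ (fun _ h => h)
    · intro s hs
      refine ⟨hs.put_left le_rfl _ _, ?_⟩
      simp only [Expr.value, Store.put_same, Function.update_self, Expr.value_congr hs hp.1,
        Expr.value_congr hs hp.2]
      -- As subtraction is truncated, `1 - (1 - (f - e))` is the indicator of `e < f`.
      by_cases h : (Formula.lt e f).Holds s₀
      · rw [if_pos h]
        simp only [Formula.Holds] at h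
        omega
      · rw [if_neg h]
        simp only [Formula.Holds] at h
        omega
    · simp only [Expr.cost, Formula.cost, Polynomial.eval_natCast]
      simp only [Nat.cast_id]; omega
  | neg p ih =>
    intro D N s₀ hp hN hD
    refine ((ih D N s₀ hp hN hD).seq (Triple.write _ _ _ ?_)).conseq (fun _ h => h) ?_
      (fun _ h => h)
    · rintro s ⟨hs, hr⟩
      refine ⟨hs.put_left le_rfl _ _, ?_⟩
      simp only [Expr.value, Store.put_same, Function.update_self, hr, Formula.Holds]
      split_ifs <;> simp_all
    · simp only [Expr.cost, Formula.cost, Polynomial.eval_natCast, Polynomial.eval_add]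
      simp only [Nat.cast_id]; omega
  | conj p q ihp ihq =>
    intro D N s₀ hp hN hD
    have hq : Triple (fun s => Agree D s s₀ ∧ s D 0 = if p.Holds s₀ then 1 else 0)
        (q.compile (D + 1)) (q.cost.eval N)
        (fun s => Agree D s s₀ ∧ (s D 0 = if p.Holds s₀ then 1 else 0) ∧
          s (D + 1) 0 = if q.Holds s₀ then 1 else 0) := by
      -- The second conjunct runs from the store `s₁` left by the first, with scratch space from `D
      -- + 1` on, so the first answer in array `D` survives.
      refine Triple.pointwise fun s₁ ⟨h1, h2⟩ => ?_
      refine (ihq (D + 1) N s₁ (hp.2.mono (by omega))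
        (fun j hj => by rw [h1 0 hD]; exact hN j hj) (by omega)).conseq ?_ le_rfl ?_
      · rintro s rfl x _; rfl
      · rintro s ⟨h3, h4⟩
        refine ⟨(h3.mono (by omega)).trans h1, ?_, ?_⟩
        · rw [h3 D (by omega), h2]
        · simp only [h4, Formula.holds_congr h1 hp.2]
    refine (((ihp D N s₀ hp.1 hN hD).seq hq).seq (Triple.write _ _ _ ?_)).conseq
      (fun _ h => h) ?_ (fun _ h => h)
    · rintro s ⟨hs, hr, hr'⟩
      refine ⟨hs.put_left le_rfl _ _, ?_⟩
      simp only [Expr.value, Store.put_same, Function.update_self, hr, hr', Formula.Holds]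
      split_ifs <;> simp_all
    · simp only [Expr.cost, Formula.cost, Polynomial.eval_natCast, Polynomial.eval_add]
      simp only [Nat.cast_id]; omega
  | atLeast e v j p ih =>
    intro D N s₀ hp hN hD
    obtain ⟨he, hv, hvD, hj, hp⟩ := hp
    -- Array `D` keeps the old value of the quantified variable, array `D + 1` counts the witnesses
    -- below `i`, and array `D + 2` receives the answer for the current value.
    let inv : ℕ → Store → Prop := fun i s => Agree D s (s₀.put v 0 i) ∧ s D 0 = s₀ v 0 ∧
      s (D + 1) 0 = ((Finset.range i).filter fun i => p.Holds (s₀.put v 0 i)).card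
    have hin : ∀ i s, inv i s → s 0 = s₀ 0 := fun i s h => by
      rw [h.1 0 hD, Store.put_of_ne _ _ _ (by omega)]
    have hbody : ∀ i < s₀ 0 j, Triple (inv i) (.seq (p.compile (D + 2))
          (.write (D + 1) (.num 0) (.add (.read (D + 1) (.num 0)) (.read (D + 2) (.num 0)))))
        (p.cost.eval N + 7)
        (fun s => s v 0 = i ∧ inv (i + 1) (s.put v 0 (i + 1))) := by
      intro i hi
      refine Triple.pointwise fun s₁ h1 => ?_
      have hp' := ih (D + 2) N s₁ (hp.mono (by omega))
        (fun j hj => by rw [hin i s₁ h1]; exact hN j hj) (by omega)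
      refine (hp'.seq (Triple.write (Q := fun s => s v 0 = i ∧ inv (i + 1) (s.put v 0 (i + 1)))
        _ _ _ ?_)).conseq ?_ ?_ (fun _ h => h)
      · rintro s ⟨h2, h3⟩
        obtain ⟨h4, h5, h6⟩ := h1
        have h7 := Formula.holds_congr h4 hp
        simp only [Expr.value]
        refine ⟨?_, ?_, ?_, ?_⟩
        · rw [Store.put_of_ne _ _ _ (by omega), h2 v (by omega), h4 v hvD, Store.put_same,
            Function.update_self]
        · have := (((h2.mono (by omega : D ≤ D + 2)).trans h4).put_left (x := D + 1)
            (by omega) 0 (s (D + 1) 0 + s (D + 2) 0)).put_right v 0 (i + 1)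
          rwa [Store.put_put] at this
        · rw [Store.put_of_ne _ _ _ (by omega), Store.put_of_ne _ _ _ (by omega),
            h2 D (by omega), h5]
        · rw [Store.put_of_ne _ _ _ (by omega), Store.put_same, Function.update_self, h3,
            h2 (D + 1) (by omega), h6, Finset.range_add_one, Finset.filter_insert]
          by_cases h8 : p.Holds (s₀.put v 0 i)
          · rw [if_pos (h7.2 h8), if_pos h8, Finset.card_insert_of_notMem (by simp)]
          · rw [if_neg (h7.not.2 h8), if_neg h8]; rfl
      · rintro s rfl x _; rfl
      · simp only [Expr.cost]; omega
    have hloop := Triple.forLoop (inv := inv) (v := v) (n := s₀ 0 j) (N := N)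
      (b := .read 0 (.num j)) (hN j hj)
      (fun i s h => by simp only [Expr.value, hin i s h])
      (fun i s h => by rw [h.1 v hvD, Store.put_same, Function.update_self]) hbody
    refine ((((Triple.seq (Triple.write (Q := fun s => Agree D s s₀ ∧ s D 0 = s₀ v 0) _ _ _ ?_)
      (Triple.write _ _ _ ?_)).seq hloop).seq (Triple.write
        (Q := fun s => Agree D s s₀ ∧ s (D + 1) 0 = ((Finset.range (s₀ 0 j)).filter
          fun i => p.Holds (s₀.put v 0 i)).card) _ _ _ ?_)).seq (Triple.write _ _ _ ?_)).conseq
      (fun _ h => h) ?_ (fun _ h => h)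
    · intro s hs
      refine ⟨hs.put_left le_rfl _ _, ?_⟩
      simp only [Expr.value, Store.put_same, Function.update_self, hs v hvD]
    · rintro s ⟨hs, hs'⟩
      simp only [Expr.value]
      refine ⟨(hs.put_left (by omega) _ _).put_right _ _ _, ?_, ?_⟩
      · rw [Store.put_of_ne _ _ _ (by omega), Store.put_of_ne _ _ _ (by omega), hs']
      · rw [Store.put_of_ne _ _ _ (by omega), Store.put_same]; simp
    · rintro s ⟨hs, hs', hs''⟩
      simp only [Expr.value]
      refine ⟨?_, ?_⟩
      -- Writing back the saved value undoes the change of `v`, so that the store agrees with `s₀`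
      -- again.
      · have := hs.put_right v 0 (s D 0)
        rwa [Store.put_put, hs', Store.put_self, ← hs'] at this
      · rw [Store.put_of_ne _ _ _ (by omega), hs'']
    · rintro s ⟨hs, hs'⟩
      refine ⟨hs.put_left le_rfl _ _, ?_⟩
      simp only [Expr.value, Store.put_same, Function.update_self, hs', Expr.value_congr hs he]
      by_cases h : (Formula.atLeast e v j p).Holds s₀
      · rw [if_pos h]
        simp only [Formula.Holds] at h
        omega
      · rw [if_neg h]
        simp only [Formula.Holds] at h
        omega
    · simp only [Expr.cost, Formula.cost, Polynomial.eval_natCast, Polynomial.eval_add,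
        Polynomial.eval_mul, Polynomial.eval_X, Polynomial.eval_one, Nat.cast_id]
      have : Polynomial.eval N p.cost + 7 + (1 + 1) + 10 = Polynomial.eval N p.cost + 19 := by ring
      rw [this]; omega

end RAM

/-! ### Lower bounds on the ranks in activity-stable matchings -/

namespace MSSPInstance

variable (I : MSSPInstance)

/-- The rank that the student `a` gives to the class `b`. -/
def sRank (a : Fin I.nA) (b : Fin I.nB) : ℕ := I.studentRank a (some b)

/-- The rank that the student `a` gives to the outside option. -/
def sNone (a : Fin I.nA) : ℕ := I.studentRank a none

/-- The rank that the class `b` gives to the student `a`. -/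
def cRank (b : Fin I.nB) (a : Fin I.nA) : ℕ := I.schoolRank b (some a)

/-- The rank that the class `b` gives to the outside option. -/
def cNone (b : Fin I.nB) : ℕ := I.schoolRank b none

/-- `R` bounds the ranks of the partners of the students in `M` from below. -/
def LowerBound (R : ℕ → ℕ) (M : Fin I.nA → Option (Fin I.nB)) : Prop :=
  ∀ a : Fin I.nA, R a ≤ I.studentRank a (M a)

/-- `a` and `a'` are siblings, in one order or the other. -/
def Sib (a a' : Fin I.nA) : Prop := (a, a') ∈ I.siblings ∨ (a', a) ∈ I.siblings

/-- If the ranks are bounded below by `R`, and `b` is the class of rank `R a` for `a`, then `a`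
cannot be assigned to `b`: it is unacceptable, or it loses against the students whose bound is
attained at `b`, or a pair containing `b` would be blocking, or a sibling of `a` has no class of
the activity of `b` left. -/
def Rejects (R : ℕ → ℕ) (a : Fin I.nA) (b : Fin I.nB) : Prop :=
  I.cNone b < I.cRank b a ∨
  I.quota b ≤ (Finset.univ.filter fun a' : Fin I.nA =>
    I.sRank a' b = R a' ∧ I.cRank b a' < I.cRank b a).card ∨
  (∃ a' : Fin I.nA, I.sRank a' b < R a' ∧ I.cRank b a' < I.cRank b a) ∨
  ∃ a', I.Sib a a' ∧ ¬ ∃ b', I.activity b' = I.activity b ∧ R a' ≤ I.sRank a' b' ∧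
    I.sRank a' b' < I.sNone a'

/-- The lower bound `R a` can be increased. -/
def CanAdvance (R : ℕ → ℕ) (a : Fin I.nA) : Prop :=
  ∃ b, I.sRank a b = R a ∧ I.Rejects R a b

/-- No student is pushed beyond the outside option, no sibling to the outside option, and no class
with a free seat has been left by a student that it accepts. -/
def Accepting (R : ℕ → ℕ) : Prop :=
  (∀ a : Fin I.nA, R a ≤ I.sNone a) ∧
  (∀ a : Fin I.nA, (∃ a', I.Sib a a') → R a < I.sNone a) ∧
  ∀ (b : Fin I.nB) (a : Fin I.nA), I.sRank a b < R a → I.cRank b a < I.cNone b →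
    I.quota b ≤ (Finset.univ.filter fun a' : Fin I.nA => I.sRank a' b = R a').card

variable {I}

theorem sRank_inj {a : Fin I.nA} {b b' : Fin I.nB} : I.sRank a b = I.sRank a b' ↔ b = b' := by
  simp [sRank, Fin.val_inj]

theorem cRank_inj {b : Fin I.nB} {a a' : Fin I.nA} : I.cRank b a = I.cRank b a' ↔ a = a' := by
  simp [cRank, Fin.val_inj]

theorem cRank_ne_cNone (b : Fin I.nB) (a : Fin I.nA) : I.cRank b a ≠ I.cNone b := by
  simp [cRank, cNone, Fin.val_inj]

theorem sRank_ne_sNone (a : Fin I.nA) (b : Fin I.nB) : I.sRank a b ≠ I.sNone a := by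
  simp [sRank, sNone, Fin.val_inj]

theorem eligible_iff {a : Fin I.nA} {b : Fin I.nB} :
    I.Eligible a b ↔ I.sRank a b < I.sNone a := Iff.rfl

theorem Sib.symm {a a' : Fin I.nA} (h : I.Sib a a') : I.Sib a' a := Or.symm h

/-! ### Soundness of increasing a lower bound -/

variable {R : ℕ → ℕ} {M : Fin I.nA → Option (Fin I.nB)}

theorem LowerBound.le_sRank (h : I.LowerBound R M) {a : Fin I.nA} {b : Fin I.nB}
    (hab : M a = some b) : R a ≤ I.sRank a b := by
  have := h a
  rwa [hab] at this

theorem IsActivityStable.eligible (hM : I.IsActivityStable M) {a : Fin I.nA} {b : Fin I.nB}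
    (hab : M a = some b) : I.sRank a b < I.sNone a := by
  have := hM.1.2.2.1 a
  rw [SchoolInstance.BlockingStudent, SchoolInstance.StudentPrefers, hab, Fin.lt_def] at this
  have h2 := sRank_ne_sNone a b
  simp only [sRank, sNone] at *
  omega

theorem IsActivityStable.sib (hM : I.IsActivityStable M) {a a' : Fin I.nA} (h : I.Sib a a') :
    ∃ b b', M a = some b ∧ M a' = some b' ∧ I.activity b = I.activity b' := by
  rcases h with h | h
  · exact hM.2 _ h
  · obtain ⟨b, b', h1, h2, h3⟩ := hM.2 _ h
    exact ⟨b', b, h2, h1, h3.symm⟩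

theorem mem_assigned {a : Fin I.nA} {b : Fin I.nB} : a ∈ I.assigned M b ↔ M a = some b := by
  simp [SchoolInstance.assigned]

/-- A class that some student would prefer holds only students that it ranks higher. -/
theorem IsActivityStable.cRank_le (hM : I.IsActivityStable M) {a a' : Fin I.nA} {b : Fin I.nB}
    (ha : I.sRank a b < I.studentRank a (M a)) (hab : M a' = some b) :
    I.cRank b a' ≤ I.cRank b a := by
  by_contra hlt
  exact hM.1.2.1 a b ⟨ha, some a', Or.inl ⟨a', mem_assigned.2 hab, rfl⟩, not_le.1 hlt⟩

/-- A class that some acceptable student would prefer is full. -/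
theorem IsActivityStable.full (hM : I.IsActivityStable M) {a : Fin I.nA} {b : Fin I.nB}
    (ha : I.sRank a b < I.studentRank a (M a)) (hab : I.cRank b a < I.cNone b) :
    I.quota b ≤ (I.assigned M b).card := by
  by_contra hlt
  exact hM.1.2.1 a b ⟨ha, none, Or.inr ⟨rfl, not_le.1 hlt⟩, hab⟩

theorem LowerBound.lt_of_ne (h : I.LowerBound R M) {a : Fin I.nA} {b : Fin I.nB}
    (hb : I.sRank a b = R a) (hab : M a ≠ some b) : I.sRank a b < I.studentRank a (M a) := by
  have h1 := h a
  have h2 : (I.studentRank a (some b) : ℕ) ≠ I.studentRank a (M a) := by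
    intro h3
    exact hab ((I.studentRank a).injective (Fin.ext h3)).symm
  simp only [sRank] at *
  omega

theorem LowerBound.ne_of_rejects (h : I.LowerBound R M) (hM : I.IsActivityStable M)
    {a : Fin I.nA} {b : Fin I.nB} (hr : I.Rejects R a b) : M a ≠ some b := by
  intro hab
  rcases hr with hr | hr | ⟨a', h1, h2⟩ | ⟨a', hs, hn⟩
  · exact hM.1.2.2.2 b ⟨a, mem_assigned.2 hab, hr⟩
  -- A student of `S` outside `b` in `M` would have a worse partner than `b`, and would block with
  -- `b` because `b` holds the less preferred `a`. So `b` holds `a` and all of `S`, more than its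
  -- quota.
  · set S := Finset.univ.filter fun a' : Fin I.nA =>
      I.sRank a' b = R a' ∧ I.cRank b a' < I.cRank b a with hS
    have haS : a ∉ S := by simp [hS]
    have hsub : insert a S ⊆ I.assigned M b := by
      intro a' ha'
      rw [mem_assigned]
      rcases Finset.mem_insert.1 ha' with rfl | ha'
      · exact hab
      · by_contra hne
        simp only [hS, Finset.mem_filter, Finset.mem_univ, true_and] at ha'
        have := hM.cRank_le (h.lt_of_ne ha'.1 hne) hab
        omega
    have := Finset.card_le_card hsub
    rw [Finset.card_insert_of_notMem haS] at this
    have := hM.1.1 b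
    omega
  -- The bound of `a'` has passed `b`, so `a'` prefers `b` to its partner in `M` and would block
  -- with `b`.
  · have := hM.cRank_le (a := a') (h1.trans_le (h a')) hab
    omega
  -- The class of the sibling in `M` is itself one of the classes claimed not to exist.
  · obtain ⟨b₁, b', h1, h2, h3⟩ := hM.sib hs
    obtain rfl : b₁ = b := by simpa [hab] using h1.symm
    exact hn ⟨b', h3.symm, h.le_sRank h2, hM.eligible h2⟩

theorem LowerBound.advance (h : I.LowerBound R M) (hM : I.IsActivityStable M) {a : Fin I.nA}
    (ha : I.CanAdvance R a) : I.LowerBound (Function.update R a (R a + 1)) M := by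
  obtain ⟨b, hb, hr⟩ := ha
  intro a'
  by_cases haa : a' = a
  · subst haa
    rw [Function.update_self, ← hb]
    exact h.lt_of_ne hb (h.ne_of_rejects hM hr)
  · rw [Function.update_of_ne (by simpa [Fin.val_inj] using haa)]
    exact h a'

/-! ### Fixed points of the lower bounds -/

/-- At a fixed point no class holds more students than its quota. -/
theorem card_le_quota (hR : ∀ a, ¬ I.CanAdvance R a) (b : Fin I.nB) :
    (Finset.univ.filter fun a' : Fin I.nA => I.sRank a' b = R a').card ≤ I.quota b := by
  set S := Finset.univ.filter fun a' : Fin I.nA => I.sRank a' b = R a' with hS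
  rcases S.eq_empty_or_nonempty with h0 | h0
  · simp [h0]
  -- For the student of `S` that `b` likes least, all others in `S` are preferred; as it is not
  -- rejected, these others are fewer than the quota.
  obtain ⟨a, ha, hmax⟩ := S.exists_max_image (I.cRank b) h0
  have hab : I.sRank a b = R a := by simpa [hS] using ha
  have h1 : ¬ I.Rejects R a b := fun h => hR a ⟨b, hab, h⟩
  simp only [Rejects, not_or, not_le] at h1
  have h2 : S.erase a ⊆ Finset.univ.filter fun a' : Fin I.nA =>
      I.sRank a' b = R a' ∧ I.cRank b a' < I.cRank b a := by
    intro a' ha'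
    rw [Finset.mem_erase] at ha'
    have h3 := hmax a' ha'.2
    have h4 : I.cRank b a' ≠ I.cRank b a := fun h => ha'.1 (cRank_inj.1 h)
    simp only [hS, Finset.mem_filter, Finset.mem_univ, true_and] at ha' ⊢
    exact ⟨ha'.2, by omega⟩
  have h5 := Finset.card_le_card h2
  rw [Finset.card_erase_of_mem ha] at h5
  omega

theorem LowerBound.accepting (h : I.LowerBound R M) (hM : I.IsActivityStable M)
    (hR : ∀ a, ¬ I.CanAdvance R a) : I.Accepting R := by
  have h0 : ∀ a : Fin I.nA, R a ≤ I.sNone a := by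
    intro a
    have h1 := h a
    have h2 := hM.1.2.2.1 a
    rw [SchoolInstance.BlockingStudent, SchoolInstance.StudentPrefers, Fin.lt_def] at h2
    simp only [sNone]; omega
  refine ⟨h0, ?_, ?_⟩
  · rintro a ⟨a', hs⟩
    obtain ⟨b, b', h1, -, -⟩ := hM.sib hs
    exact (h.le_sRank h1).trans_lt (hM.eligible h1)
  intro b a hab hacc
  by_contra hlt
  set S : Fin I.nB → Finset (Fin I.nA) := fun b =>
    Finset.univ.filter fun a' : Fin I.nA => I.sRank a' b = R a' with hS
  have hfull := hM.full (hab.trans_le (h a)) hacc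
  -- If a student of `S b` is not at `b` in `M`, it prefers `b` to its partner. It is acceptable to
  -- `b`, not being rejected, so `b` is full in `M`, and `card_le_quota` applies.
  have hle : ∀ b, (S b).card ≤ (I.assigned M b).card := by
    intro b
    by_cases hsub : S b ⊆ I.assigned M b
    · exact Finset.card_le_card hsub
    obtain ⟨a, haS, haM⟩ := Finset.not_subset.1 hsub
    rw [mem_assigned] at haM
    simp only [hS, Finset.mem_filter, Finset.mem_univ, true_and] at haS
    have h1 : ¬ I.Rejects R a b := fun h => hR a ⟨b, haS, h⟩
    simp only [Rejects, not_or, not_lt] at h1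
    have h2 := cRank_ne_cNone b a
    exact (card_le_quota hR b).trans (hM.full (h.lt_of_ne haS haM) (by omega))
  -- A class violating the last condition of `Accepting` is full in `M` but not under `R`, which
  -- makes the inequality of the sums strict.
  have hsum : ∑ b, (S b).card < ∑ b, (I.assigned M b).card :=
    Finset.sum_lt_sum (fun b _ => hle b) ⟨b, Finset.mem_univ _, by
      have := not_le.1 hlt
      simp only [hS]; omega⟩
  have hdisj : ∀ b ∈ (Finset.univ : Finset (Fin I.nB)), ∀ b' ∈ (Finset.univ : Finset (Fin I.nB)),
      b ≠ b' → Disjoint (I.assigned M b) (I.assigned M b') := by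
    intro b _ b' _ hne
    rw [Finset.disjoint_left]
    intro a h1 h2
    rw [mem_assigned] at h1 h2
    rw [h1] at h2
    exact hne (Option.some.inj h2)
  -- For a student matched in `M`, `R a` lies below the rank of the outside option, so the option of
  -- rank `R a` is a class. This gives the opposite inequality of the sums.
  have hcov : Finset.univ.biUnion (I.assigned M) ⊆ Finset.univ.biUnion S := by
    intro a ha
    simp only [Finset.mem_biUnion, Finset.mem_univ, true_and, mem_assigned] at ha ⊢
    obtain ⟨b, hb⟩ := ha
    have hlt := (h.le_sRank hb).trans_lt (hM.eligible hb)
    have hlt' : R a < I.nB + 1 := hlt.trans (I.studentRank a none).isLt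
    rcases hx : (I.studentRank a).symm ⟨R a, hlt'⟩ with _ | b'
    · rw [Equiv.symm_apply_eq] at hx
      have : R a = I.sNone a := by simp [sNone, ← hx]
      omega
    · rw [Equiv.symm_apply_eq] at hx
      exact ⟨b', Finset.mem_filter.2 ⟨Finset.mem_univ _, by simp [sRank, ← hx]⟩⟩
  have h1 := Finset.card_le_card hcov
  rw [Finset.card_biUnion hdisj] at h1
  have h2 : (Finset.univ.biUnion S).card ≤ ∑ b, (S b).card := Finset.card_biUnion_le
  omega

theorem Accepting.exists_isActivityStable (h : I.Accepting R) (hR : ∀ a, ¬ I.CanAdvance R a) :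
    ∃ M, I.IsActivityStable M := by
  obtain ⟨h0, h1, h2⟩ := h
  have hlt : ∀ a : Fin I.nA, R a < I.nB + 1 := fun a =>
    (h0 a).trans_lt (I.studentRank a none).isLt
  let M : Fin I.nA → Option (Fin I.nB) := fun a => (I.studentRank a).symm ⟨R a, hlt a⟩
  have hrank : ∀ a, (I.studentRank a (M a) : ℕ) = R a := fun a => by simp [M]
  have hMb : ∀ a b, M a = some b ↔ I.sRank a b = R a := fun a b => by
    simp only [M, Equiv.symm_apply_eq, sRank, Fin.ext_iff]
    exact eq_comm
  have hass : ∀ b, I.assigned M b =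
      Finset.univ.filter fun a' : Fin I.nA => I.sRank a' b = R a' := fun b => by
    ext a; simp [mem_assigned, hMb]
  have hrej : ∀ a b, M a = some b → ¬ I.Rejects R a b :=
    fun a b hab h => hR a ⟨b, (hMb a b).1 hab, h⟩
  refine ⟨M, ⟨?_, ?_, ?_, ?_⟩, ?_⟩
  · intro b
    rw [hass]
    exact card_le_quota hR b
  · rintro a b ⟨ha, x, hx, hpref⟩
    have ha' : I.sRank a b < R a := by rw [← hrank]; exact ha
    rcases hx with ⟨a', ha1, rfl⟩ | ⟨rfl, hcard⟩
    -- In a blocking pair, `a` has left `b`, so `b` would have rejected each student it likes less.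
    · exact hrej a' b (mem_assigned.1 ha1) (Or.inr (Or.inr (Or.inl ⟨a, ha', hpref⟩)))
    · rw [hass] at hcard
      exact absurd (h2 b a ha' hpref) (not_le.2 hcard)
  · intro a ha
    have := h0 a
    rw [SchoolInstance.BlockingStudent, SchoolInstance.StudentPrefers, Fin.lt_def, hrank] at ha
    simp only [sNone] at this
    omega
  · rintro b ⟨a, ha, hpref⟩
    exact hrej a b (mem_assigned.1 ha) (Or.inl hpref)
  · rintro ⟨a, a'⟩ hp
    have hs : I.Sib a a' := Or.inl hp
    have hex : ∀ a, (∃ a', I.Sib a a') → ∃ b, M a = some b := by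
      intro a ha
      have h3 := h1 a ha
      rcases hx : M a with _ | b
      · have := hrank a
        rw [hx] at this
        simp only [sNone] at h3
        omega
      · exact ⟨b, rfl⟩
    obtain ⟨b, hb⟩ := hex a ⟨a', hs⟩
    obtain ⟨b', hb'⟩ := hex a' ⟨a, hs.symm⟩
    refine ⟨b, b', hb, hb', ?_⟩
    have hRa := (hMb a b).1 hb
    have hRa' := (hMb a' b').1 hb'
    have e1 : I.Eligible a b := by
      rw [eligible_iff, hRa]; exact h1 a ⟨a', hs⟩
    have e2 : I.Eligible a' b' := by
      rw [eligible_iff, hRa']; exact h1 a' ⟨a, hs.symm⟩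
    have r1 := hrej a b hb
    have r2 := hrej a' b' hb'
    simp only [Rejects, not_or, not_exists, not_and, not_forall, not_not] at r1 r2
    -- Since neither sibling is rejected, `a'` has an eligible class `c'` of the activity of `b`, no
    -- better than `b'`, and `a` has an eligible class `c` of the activity of `b'`, no better than
    -- `b`. If the activities differ, `a` strictly prefers `b` to `c`, and the common order makes
    -- `a'` prefer `c'` to `b'`.
    obtain ⟨c', hc1, hc2, hc3⟩ := r1.2.2.2 a' hs
    obtain ⟨c, hd1, hd2, hd3⟩ := r2.2.2.2 a hs.symm
    by_contra hne
    have key := I.same_order (a, a') hp b c c' b' e1 (eligible_iff.2 hd3) (eligible_iff.2 hc3) e2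
      hc1.symm hd1
    have hbc : I.sRank a b < I.sRank a c := by
      have : I.sRank a b ≠ I.sRank a c := fun h => hne (by rw [sRank_inj.1 h, hd1])
      omega
    have h5 : I.sRank a' c' < I.sRank a' b' := key.1 hbc
    omega

end MSSPInstance

/-! ### Positions in the encoding -/

theorem List.getD_flatMap_finRange {m : ℕ} : ∀ {n : ℕ} (f : Fin n → List ℕ),
    (∀ i, (f i).length = m) → ∀ (i : Fin n) (j : ℕ), j < m →
      ((List.finRange n).flatMap f).getD (i * m + j) 0 = (f i).getD j 0
  | 0, _, _, i, _, _ => i.elim0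
  | n + 1, f, hf, i, j, hj => by
    rw [List.finRange_succ, List.flatMap_cons, List.flatMap_map]
    refine Fin.cases ?_ (fun i => ?_) i
    · rw [List.getD_append _ _ _ _ (by simp [hf, hj])]
      simp
    · rw [List.getD_append_right _ _ _ _ (by simp [hf, add_mul]; omega)]
      rw [← List.getD_flatMap_finRange (fun i => f i.succ) (fun i => hf _) i j hj]
      congr 1
      simp [hf, add_mul]; omega

theorem List.length_flatMap_finRange {n m : ℕ} (f : Fin n → List ℕ)
    (hf : ∀ i, (f i).length = m) : ((List.finRange n).flatMap f).length = n * m := by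
  simp [List.length_flatMap, hf]

theorem List.getD_map_finRange {n : ℕ} (f : Fin n → ℕ) (i : Fin n) :
    ((List.finRange n).map f).getD i 0 = f i := by
  simp [List.getD_eq_getElem?_getD]

namespace MSSPInstance

variable (I : MSSPInstance)

/-- The position of the ranks given by the student number `i`. -/
def studentPos (i : ℕ) : ℕ := 3 + i * (I.nB + 1)

/-- The position of the ranks given by the class number `i`. -/
def classPos (i : ℕ) : ℕ := I.studentPos I.nA + i * (I.nA + 1)

/-- The position of row number `i` of the incidence matrix of the set of siblings. -/
def siblingPos (i : ℕ) : ℕ := I.classPos I.nB + I.nB + I.nB + i * I.nA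

/-- The content of position `i` of the encoding. -/
def entry (i : ℕ) : ℕ := I.encode.getD i 0

theorem entry_zero : I.entry 0 = I.nA := rfl

theorem entry_one : I.entry 1 = I.nB := rfl

theorem length_studentRow (a : Fin I.nA) :
    ((none :: (List.finRange I.nB).map some).map
      fun x => (I.studentRank a x : ℕ)).length = I.nB + 1 := by simp

theorem length_classRow (b : Fin I.nB) :
    ((none :: (List.finRange I.nA).map some).map
      fun x => (I.schoolRank b x : ℕ)).length = I.nA + 1 := by simp

theorem length_siblingRow (a : Fin I.nA) :
    ((List.finRange I.nA).map fun a' => if (a, a') ∈ I.siblings then 1 else 0).length = I.nA := by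
  simp

theorem length_encode : I.encode.length = I.siblingPos I.nA := by
  simp only [encode, List.length_append, List.length_flatMap_finRange _ I.length_studentRow,
    List.length_flatMap_finRange _ I.length_classRow,
    List.length_flatMap_finRange _ I.length_siblingRow, List.length_map, List.length_finRange,
    siblingPos, classPos, studentPos]
  rfl

theorem entry_student (a : Fin I.nA) (j : ℕ) (hj : j < I.nB + 1) :
    I.entry (I.studentPos a + j) =
      ((none :: (List.finRange I.nB).map some).map fun x => (I.studentRank a x : ℕ)).getD j 0 := by
  have hlt : (a : ℕ) * (I.nB + 1) + j < I.nA * (I.nB + 1) := by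
    have : ((a : ℕ) + 1) * (I.nB + 1) ≤ I.nA * (I.nB + 1) := Nat.mul_le_mul_right _ a.isLt
    rw [add_mul] at this
    omega
  rw [← List.getD_flatMap_finRange _ I.length_studentRow a j hj, entry, encode]
  simp only [List.append_assoc]
  rw [List.getD_append_right _ _ _ _ (by simp [studentPos]; omega),
    List.getD_append _ _ _ _ (by
      rw [List.length_flatMap_finRange _ I.length_studentRow]; simp [studentPos]; omega)]
  congr 1
  simp [studentPos]; omega

theorem length_preferences : ([I.nA, I.nB, I.k]
    ++ (List.finRange I.nA).flatMap (fun a =>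
        (none :: (List.finRange I.nB).map some).map fun x => (I.studentRank a x : ℕ))
    ++ (List.finRange I.nB).flatMap (fun b =>
        (none :: (List.finRange I.nA).map some).map fun x => (I.schoolRank b x : ℕ))).length =
    I.classPos I.nB := by
  rw [List.length_append, List.length_append, List.length_flatMap_finRange _ I.length_studentRow,
    List.length_flatMap_finRange _ I.length_classRow]
  simp [studentPos, classPos]

theorem entry_class (b : Fin I.nB) (j : ℕ) (hj : j < I.nA + 1) :
    I.entry (I.classPos b + j) =
      ((none :: (List.finRange I.nA).map some).map fun x => (I.schoolRank b x : ℕ)).getD j 0 := by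
  have hlt : I.classPos b + j < I.classPos I.nB := by
    have : ((b : ℕ) + 1) * (I.nA + 1) ≤ I.nB * (I.nA + 1) := Nat.mul_le_mul_right _ b.isLt
    rw [add_mul] at this
    simp only [classPos]
    omega
  have hlen := I.length_preferences
  rw [← List.getD_flatMap_finRange _ I.length_classRow b j hj, entry, encode,
    List.getD_append _ _ _ _ (by rw [List.length_append, List.length_append, hlen]; omega),
    List.getD_append _ _ _ _ (by rw [List.length_append, hlen]; omega),
    List.getD_append _ _ _ _ (by rw [hlen]; omega),
    List.getD_append_right _ _ _ _ (by
      rw [List.length_append, List.length_flatMap_finRange _ I.length_studentRow]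
      simp [studentPos, classPos]; omega)]
  congr 1
  rw [List.length_append, List.length_flatMap_finRange _ I.length_studentRow]
  simp [studentPos, classPos]; omega

theorem entry_quota (b : Fin I.nB) : I.entry (I.classPos I.nB + b) = I.quota b := by
  have hlen := I.length_preferences
  rw [← List.getD_map_finRange I.quota b, entry, encode,
    List.getD_append _ _ _ _ (by
      rw [List.length_append, List.length_append, hlen]; simp; omega),
    List.getD_append _ _ _ _ (by rw [List.length_append, hlen]; simp),
    List.getD_append_right _ _ _ _ (by rw [hlen]; omega), hlen]
  simp

theorem entry_activity (b : Fin I.nB) :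
    I.entry (I.classPos I.nB + I.nB + b) = I.activity b := by
  rw [← List.getD_map_finRange (fun b => (I.activity b : ℕ)) b, entry, encode]
  rw [List.getD_append _ _ _ _ (by
    rw [List.length_append, List.length_append, length_preferences]; simp)]
  rw [List.getD_append_right _ _ _ _ (by
    rw [List.length_append, length_preferences]; simp)]
  rw [List.length_append, length_preferences]
  simp

theorem entry_sibling (a a' : Fin I.nA) :
    I.entry (I.siblingPos a + a') = if (a, a') ∈ I.siblings then 1 else 0 := by
  rw [← List.getD_map_finRange (fun a' => if (a, a') ∈ I.siblings then 1 else 0) a',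
    ← List.getD_flatMap_finRange _ I.length_siblingRow a a' a'.isLt, entry, encode,
    List.getD_append_right _ _ _ _ (by
      rw [List.length_append, List.length_append, length_preferences]; simp [siblingPos]; omega)]
  congr 1
  rw [List.length_append, List.length_append, length_preferences]
  simp [siblingPos]; omega

theorem entry_sNone (a : Fin I.nA) : I.entry (I.studentPos a) = I.sNone a :=
  I.entry_student a 0 (by omega)

theorem entry_sRank (a : Fin I.nA) (b : Fin I.nB) :
    I.entry (I.studentPos a + b + 1) = I.sRank a b := by
  -- Column `0` of a row belongs to the outside option, so the class `b` has column `b + 1`.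
  rw [add_assoc, I.entry_student a (b + 1) (by omega)]
  simp [List.getD_eq_getElem?_getD, sRank]

theorem entry_cNone (b : Fin I.nB) : I.entry (I.classPos b) = I.cNone b :=
  I.entry_class b 0 (by omega)

theorem entry_cRank (b : Fin I.nB) (a : Fin I.nA) :
    I.entry (I.classPos b + a + 1) = I.cRank b a := by
  rw [add_assoc, I.entry_class b (a + 1) (by omega)]
  simp [List.getD_eq_getElem?_getD, cRank]

/-! ### Size bounds for the encoding -/

theorem length_le_bitSize (w : List ℕ) : w.length ≤ RAM.bitSize w := by
  induction w with
  | nil => simp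
  | cons n w ih =>
    simp only [RAM.bitSize, List.map_cons, List.sum_cons, List.length_cons] at *
    omega

/-- This justifies the input length as the number of rounds: it exceeds the largest possible sum of
the bounds and is available without a multiplication. -/
theorem lt_length_encode : I.nA * (I.nB + 1) < I.encode.length := by
  rw [length_encode]
  simp only [siblingPos, classPos, studentPos]
  omega

theorem nA_le_length_encode : I.nA ≤ I.encode.length := by
  rw [length_encode]
  simp only [siblingPos, classPos, studentPos, mul_add]
  omega

theorem nB_le_length_encode : I.nB ≤ I.encode.length := by
  rw [length_encode]
  simp only [siblingPos, classPos, studentPos, mul_add]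
  omega

end MSSPInstance

/-! ### The program -/

namespace RAM

/-- The scalar variable `x`. -/
def var (x : ℕ) : Expr := .read x (.num 0)

/-- The formula `e ≤ f`. -/
def Formula.le (e f : Expr) : Formula := .neg (.lt f e)

/-- The formula `e = f`. -/
def Formula.eq (e f : Expr) : Formula := .conj (.le e f) (.le f e)

/-- The disjunction of two formulas. -/
def Formula.disj (p q : Formula) : Formula := .neg (.conj (.neg p) (.neg q))

/-- The implication between two formulas. -/
def Formula.imp (p q : Formula) : Formula := .neg (.conj p (.neg q))

/-- Existential quantification over the variable `v`, bounded by cell `j` of the input. -/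
def Formula.ex (v j : ℕ) (p : Formula) : Formula := .atLeast (.num 1) v j p

/-- Universal quantification over the variable `v`, bounded by cell `j` of the input. -/
def Formula.all (v j : ℕ) (p : Formula) : Formula := .neg (.ex v j (.neg p))

/-- The rank that the student in the variable `x` gives to the class in the variable `y`. -/
def sRankExpr (x y : ℕ) : Expr := .read 0 (.add (.add (.read 3 (var x)) (var y)) (.num 1))

/-- The rank that the student in the variable `x` gives to the outside option. -/
def sNoneExpr (x : ℕ) : Expr := .read 0 (.read 3 (var x))

/-- The rank that the class in the variable `y` gives to the student in the variable `x`. -/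
def cRankExpr (y x : ℕ) : Expr := .read 0 (.add (.add (.read 4 (var y)) (var x)) (.num 1))

/-- The rank that the class in the variable `y` gives to the outside option. -/
def cNoneExpr (y : ℕ) : Expr := .read 0 (.read 4 (var y))

/-- The quota of the class in the variable `y`. -/
def quotaExpr (y : ℕ) : Expr := .read 0 (.add (.read 4 (.read 0 (.num 1))) (var y))

/-- The activity of the class in the variable `y`. -/
def activityExpr (y : ℕ) : Expr :=
  .read 0 (.add (.add (.read 4 (.read 0 (.num 1))) (.read 0 (.num 1))) (var y))

/-- The lower bound for the student in the variable `x`. -/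
def boundExpr (x : ℕ) : Expr := .read 6 (var x)

/-- The formula saying that the students in the variables `x` and `y` are siblings. -/
def sibFormula (x y : ℕ) : Formula :=
  .disj (.lt (.num 0) (.read 0 (.add (.read 5 (var x)) (var y))))
    (.lt (.num 0) (.read 0 (.add (.read 5 (var y)) (var x))))

/-- The formula saying that the class in the variable `9` rejects the student in the variable
`8`. -/
def rejectsFormula : Formula :=
  .disj (.lt (cNoneExpr 9) (cRankExpr 9 8)) <|
  .disj (.atLeast (quotaExpr 9) 10 0 (.conj (.eq (sRankExpr 10 9) (boundExpr 10))
    (.lt (cRankExpr 9 10) (cRankExpr 9 8)))) <|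
  .disj (.ex 10 0 (.conj (.lt (sRankExpr 10 9) (boundExpr 10))
    (.lt (cRankExpr 9 10) (cRankExpr 9 8)))) <|
  .ex 10 0 (.conj (sibFormula 8 10) (.neg (.ex 11 1 (.conj (.eq (activityExpr 11) (activityExpr 9))
    (.conj (.le (boundExpr 10) (sRankExpr 10 11)) (.lt (sRankExpr 10 11) (sNoneExpr 10)))))))

/-- The formula saying that the lower bound for the student in the variable `8` can be
increased. -/
def advanceFormula : Formula :=
  .ex 9 1 (.conj (.eq (sRankExpr 8 9) (boundExpr 8)) rejectsFormula)

/-- The formula that decides the answer from the final lower bounds. -/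
def acceptingFormula : Formula :=
  .conj (.all 8 0 (.le (boundExpr 8) (sNoneExpr 8))) <|
  .conj (.all 8 0 (.imp (.ex 10 0 (sibFormula 8 10)) (.lt (boundExpr 8) (sNoneExpr 8)))) <|
  .all 9 1 <| .all 8 0 <| .imp (.lt (sRankExpr 8 9) (boundExpr 8)) <|
    .imp (.lt (cRankExpr 9 8) (cNoneExpr 9)) <|
      .atLeast (quotaExpr 9) 10 0 (.eq (sRankExpr 10 9) (boundExpr 10))

/-- The program that fills the array `x` with the values from cell `0` on in steps of `e`, as far
as cell number `b`. -/
def fillProgram (x : ℕ) (b e : Expr) : Program :=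
  forLoop 7 b (.write x (.add (var 7) (.num 1)) (.add (.read x (var 7)) e))

/-- The program that computes the positions of the rows of the input. -/
def initProgram : Program :=
  .seq (.seq (.seq (.seq (.seq
    (.write 3 (.num 0) (.num 3))
    (fillProgram 3 (.read 0 (.num 0)) (.add (.read 0 (.num 1)) (.num 1))))
    (.write 4 (.num 0) (.read 3 (.read 0 (.num 0)))))
    (fillProgram 4 (.read 0 (.num 1)) (.add (.read 0 (.num 0)) (.num 1))))
    (.write 5 (.num 0) (.add (.add (.read 4 (.read 0 (.num 1))) (.read 0 (.num 1)))
      (.read 0 (.num 1)))))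
    (fillProgram 5 (.read 0 (.num 0)) (.read 0 (.num 0)))

/-- The program that increases the lower bound for the student in the variable `8` if it can be
increased. -/
def advanceProgram : Program :=
  .seq (advanceFormula.compile 13)
    (.cond (var 13) (.write 6 (var 8) (.add (.read 6 (var 8)) (.num 1))) .skip)

/-- The program that computes a fixed point of the lower bounds. -/
def fixProgram : Program :=
  forLoop 7 (.read 1 (.num 0)) (forLoop 8 (.read 0 (.num 0)) advanceProgram)

/-- The program that decides whether there is an activity-stable matching. -/
def msspProgram : Program :=
  .seq (.seq (.seq initProgram fixProgram) (acceptingFormula.compile 13))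
    (.write 2 (.num 0) (var 13))

/-! ### Meaning of the derived connectives and quantifiers -/

@[simp] theorem holds_lt {s : Store} {e f : Expr} :
    (Formula.lt e f).Holds s ↔ e.value s < f.value s := Iff.rfl

@[simp] theorem holds_neg {s : Store} {p : Formula} : p.neg.Holds s ↔ ¬ p.Holds s := Iff.rfl

@[simp] theorem holds_conj {s : Store} {p q : Formula} :
    (p.conj q).Holds s ↔ p.Holds s ∧ q.Holds s := Iff.rfl

@[simp] theorem holds_le {s : Store} {e f : Expr} :
    (Formula.le e f).Holds s ↔ e.value s ≤ f.value s := by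
  simp [Formula.le]

@[simp] theorem holds_eq {s : Store} {e f : Expr} :
    (Formula.eq e f).Holds s ↔ e.value s = f.value s := by
  simp [Formula.eq, le_antisymm_iff]

@[simp] theorem holds_disj {s : Store} {p q : Formula} :
    (p.disj q).Holds s ↔ p.Holds s ∨ q.Holds s := by
  simp only [Formula.disj, holds_neg, holds_conj]; tauto

@[simp] theorem holds_imp {s : Store} {p q : Formula} :
    (p.imp q).Holds s ↔ (p.Holds s → q.Holds s) := by
  simp [Formula.imp]

open Classical in
theorem holds_atLeast {s : Store} {e : Expr} {v j n : ℕ} {p : Formula} (hn : s 0 j = n) :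
    (Formula.atLeast e v j p).Holds s ↔
      e.value s ≤ (Finset.univ.filter fun i : Fin n => p.Holds (s.put v 0 i)).card := by
  simp only [Formula.Holds, hn, Finset.card_filter]
  rw [Fin.sum_univ_eq_sum_range fun i => if p.Holds (s.put v 0 i) then 1 else 0]

theorem holds_ex {s : Store} {v j n : ℕ} {p : Formula} (hn : s 0 j = n) :
    (Formula.ex v j p).Holds s ↔ ∃ i : Fin n, p.Holds (s.put v 0 i) := by
  classical
  rw [Formula.ex, holds_atLeast hn, Expr.value, Nat.one_le_iff_ne_zero, Ne, Finset.card_eq_zero,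
    Finset.filter_eq_empty_iff]
  simp

theorem holds_all {s : Store} {v j n : ℕ} {p : Formula} (hn : s 0 j = n) :
    (Formula.all v j p).Holds s ↔ ∀ i : Fin n, p.Holds (s.put v 0 i) := by
  simp [Formula.all, holds_ex hn]

theorem value_var {s : Store} {x : ℕ} : (var x).value s = s x 0 := rfl

end RAM

/-! ### Meaning of the formulas in a store with the tables of positions -/

namespace MSSPInstance

open RAM

variable {I : MSSPInstance}

variable (I) in
/-- The input and the arrays of positions are in place. -/
structure Ready (s : Store) : Prop where
  input : s 0 = I.entry
  length : s 1 0 = I.encode.length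
  student : ∀ i ≤ I.nA, s 3 i = I.studentPos i
  cls : ∀ i ≤ I.nB, s 4 i = I.classPos i
  sibling : ∀ i ≤ I.nA, s 5 i = I.siblingPos i

theorem Ready.nA {s : Store} (h : I.Ready s) : s 0 0 = I.nA := by rw [h.input, I.entry_zero]

theorem Ready.nB {s : Store} (h : I.Ready s) : s 0 1 = I.nB := by rw [h.input, I.entry_one]

theorem Ready.congr {s s' : Store} (h : I.Ready s) (hs : ∀ x < 6, s' x = s x) : I.Ready s' where
  input := by rw [hs 0 (by omega), h.input]
  length := by rw [hs 1 (by omega), h.length]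
  student := by rw [hs 3 (by omega)]; exact h.student
  cls := by rw [hs 4 (by omega)]; exact h.cls
  sibling := by rw [hs 5 (by omega)]; exact h.sibling

theorem Ready.put {s : Store} (h : I.Ready s) {x : ℕ} (hx : 6 ≤ x) (i n : ℕ) :
    I.Ready (s.put x i n) :=
  h.congr fun y hy => s.put_of_ne i n (by omega)

theorem Ready.value_sRankExpr {s : Store} (h : I.Ready s) {x y : ℕ} {a : Fin I.nA} {b : Fin I.nB}
    (ha : s x 0 = a) (hb : s y 0 = b) : (sRankExpr x y).value s = I.sRank a b := by
  simp only [sRankExpr, Expr.value, value_var, ha, hb, h.student a a.isLt.le, h.input, entry_sRank]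

theorem Ready.value_sNoneExpr {s : Store} (h : I.Ready s) {x : ℕ} {a : Fin I.nA}
    (ha : s x 0 = a) : (sNoneExpr x).value s = I.sNone a := by
  simp only [sNoneExpr, Expr.value, value_var, ha, h.student a a.isLt.le, h.input, entry_sNone]

theorem Ready.value_cRankExpr {s : Store} (h : I.Ready s) {x y : ℕ} {a : Fin I.nA} {b : Fin I.nB}
    (hb : s y 0 = b) (ha : s x 0 = a) : (cRankExpr y x).value s = I.cRank b a := by
  simp only [cRankExpr, Expr.value, value_var, ha, hb, h.cls b b.isLt.le, h.input, entry_cRank]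

theorem Ready.value_cNoneExpr {s : Store} (h : I.Ready s) {y : ℕ} {b : Fin I.nB}
    (hb : s y 0 = b) : (cNoneExpr y).value s = I.cNone b := by
  simp only [cNoneExpr, Expr.value, value_var, hb, h.cls b b.isLt.le, h.input, entry_cNone]

theorem Ready.value_quotaExpr {s : Store} (h : I.Ready s) {y : ℕ} {b : Fin I.nB}
    (hb : s y 0 = b) : (quotaExpr y).value s = I.quota b := by
  simp only [quotaExpr, Expr.value, value_var, hb, h.nB, h.cls I.nB le_rfl]
  rw [h.input, entry_quota]

theorem Ready.value_activityExpr {s : Store} (h : I.Ready s) {y : ℕ} {b : Fin I.nB}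
    (hb : s y 0 = b) : (activityExpr y).value s = I.activity b := by
  simp only [activityExpr, Expr.value, value_var, hb, h.nB, h.cls I.nB le_rfl]
  rw [h.input, entry_activity]

theorem value_boundExpr {s : Store} {x : ℕ} {a : Fin I.nA} (ha : s x 0 = a) :
    (boundExpr x).value s = s 6 a := by
  simp only [boundExpr, Expr.value, value_var, ha]

theorem Ready.holds_sibFormula {s : Store} (h : I.Ready s) {x y : ℕ} {a a' : Fin I.nA}
    (ha : s x 0 = a) (ha' : s y 0 = a') : (sibFormula x y).Holds s ↔ I.Sib a a' := by
  have key : ∀ a a' : Fin I.nA, 0 < s 0 (s 5 a + a') ↔ (a, a') ∈ I.siblings := by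
    intro a a'
    rw [h.sibling a a.isLt.le, h.input, entry_sibling]
    split_ifs <;> simp_all
  simp only [sibFormula, holds_disj, holds_lt, Expr.value, value_var, ha, ha', key, Sib]

theorem Ready.holds_rejectsFormula {s : Store} (h : I.Ready s) {a : Fin I.nA} {b : Fin I.nB}
    (ha : s 8 0 = a) (hb : s 9 0 = b) : rejectsFormula.Holds s ↔ I.Rejects (s 6) a b := by
  have h10 : ∀ a' : Fin I.nA, I.Ready (s.put 10 0 a') := fun a' => h.put (by omega) _ _
  have hv : ∀ n, s.put 10 0 n 10 0 = n := fun n => by simp [Store.put_same]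
  have hva : ∀ n, s.put 10 0 n 8 0 = a := fun n => by rw [Store.put_of_ne _ _ _ (by omega), ha]
  have hvb : ∀ n, s.put 10 0 n 9 0 = b := fun n => by rw [Store.put_of_ne _ _ _ (by omega), hb]
  have hv6 : ∀ n, s.put 10 0 n 6 = s 6 := fun n => Store.put_of_ne _ _ _ (by omega)
  simp only [rejectsFormula, holds_disj, holds_lt, h.value_cNoneExpr hb, h.value_cRankExpr hb ha,
    Rejects, holds_ex h.nA, holds_conj, holds_neg]
  refine or_congr Iff.rfl (or_congr ?_ (or_congr ?_ ?_))
  · rw [holds_atLeast h.nA, h.value_quotaExpr hb]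
    have : ∀ a' : Fin I.nA, ((Formula.eq (sRankExpr 10 9) (boundExpr 10)).conj
        (.lt (cRankExpr 9 10) (cRankExpr 9 8))).Holds (s.put 10 0 a') ↔
        I.sRank a' b = s 6 a' ∧ I.cRank b a' < I.cRank b a := fun a' => by
      rw [holds_conj, holds_eq, holds_lt, (h10 a').value_sRankExpr (hv _) (hvb _),
        value_boundExpr (hv _), (h10 a').value_cRankExpr (hvb _) (hv _),
        (h10 a').value_cRankExpr (hvb _) (hva _), hv6]
    simp only [this]
  · refine exists_congr fun a' => ?_
    rw [(h10 a').value_sRankExpr (hv _) (hvb _), value_boundExpr (hv _),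
      (h10 a').value_cRankExpr (hvb _) (hv _), (h10 a').value_cRankExpr (hvb _) (hva _), hv6]
  · refine exists_congr fun a' => ?_
    rw [(h10 a').holds_sibFormula (hva _) (hv _), holds_ex (h10 a').nB]
    refine and_congr Iff.rfl (not_congr (exists_congr fun b' => ?_))
    have h11 : I.Ready ((s.put 10 0 a').put 11 0 b') := (h10 a').put (by omega) _ _
    have e1 : (s.put 10 0 a').put 11 0 b' 11 0 = b' := by simp [Store.put_same]
    have e2 : (s.put 10 0 a').put 11 0 b' 10 0 = a' := by
      rw [Store.put_of_ne _ _ _ (by omega), hv]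
    have e3 : (s.put 10 0 a').put 11 0 b' 9 0 = b := by
      rw [Store.put_of_ne _ _ _ (by omega), hvb]
    have e4 : (s.put 10 0 a').put 11 0 b' 6 = s 6 := by
      rw [Store.put_of_ne _ _ _ (by omega), hv6]
    rw [holds_conj, holds_conj, holds_eq, holds_le, holds_lt, h11.value_activityExpr e1,
      h11.value_activityExpr e3, value_boundExpr e2, h11.value_sRankExpr e2 e1,
      h11.value_sNoneExpr e2, e4, Fin.val_inj]

theorem Ready.holds_advanceFormula {s : Store} (h : I.Ready s) {a : Fin I.nA}
    (ha : s 8 0 = a) : advanceFormula.Holds s ↔ I.CanAdvance (s 6) a := by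
  rw [advanceFormula, holds_ex h.nB, CanAdvance]
  refine exists_congr fun b => ?_
  have h9 : I.Ready (s.put 9 0 b) := h.put (by omega) _ _
  have e1 : s.put 9 0 b 9 0 = b := by simp [Store.put_same]
  have e2 : s.put 9 0 b 8 0 = a := by rw [Store.put_of_ne _ _ _ (by omega), ha]
  have e3 : s.put 9 0 b 6 = s 6 := Store.put_of_ne _ _ _ (by omega)
  rw [holds_conj, holds_eq, h9.value_sRankExpr e2 e1, value_boundExpr e2,
    h9.holds_rejectsFormula e2 e1, e3]

theorem Ready.holds_acceptingFormula {s : Store} (h : I.Ready s) :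
    acceptingFormula.Holds s ↔ I.Accepting (s 6) := by
  have h8 : ∀ a : Fin I.nA, I.Ready (s.put 8 0 a) := fun a => h.put (by omega) _ _
  have e8 : ∀ a : Fin I.nA, s.put 8 0 a 8 0 = a := fun a => by simp [Store.put_same]
  have e6 : ∀ n, s.put 8 0 n 6 = s 6 := fun n => Store.put_of_ne _ _ _ (by omega)
  rw [acceptingFormula, holds_conj, holds_conj, holds_all h.nA, holds_all h.nA, holds_all h.nB,
    Accepting]
  refine and_congr (forall_congr' fun a => ?_) (and_congr (forall_congr' fun a => ?_)
    (forall_congr' fun b => ?_))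
  · rw [holds_le, value_boundExpr (e8 a), (h8 a).value_sNoneExpr (e8 a), e6]
  · rw [holds_imp, holds_lt, value_boundExpr (e8 a), (h8 a).value_sNoneExpr (e8 a), e6,
      holds_ex (h8 a).nA]
    refine imp_congr (exists_congr fun a' => ?_) Iff.rfl
    refine ((h8 a).put (by omega) _ _).holds_sibFormula ?_ ?_
    · rw [Store.put_of_ne _ _ _ (by omega), e8]
    · simp [Store.put_same]
  · have h9 : I.Ready (s.put 9 0 b) := h.put (by omega) _ _
    rw [holds_all h9.nA]
    refine forall_congr' fun a => ?_
    set s' := (s.put 9 0 b).put 8 0 a with hs'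
    have h' : I.Ready s' := h9.put (by omega) _ _
    have f8 : s' 8 0 = a := by simp [hs', Store.put_same]
    have f9 : s' 9 0 = b := by
      rw [hs', Store.put_of_ne _ _ _ (by omega)]; simp [Store.put_same]
    have f6 : s' 6 = s 6 := by
      rw [hs', Store.put_of_ne _ _ _ (by omega), Store.put_of_ne _ _ _ (by omega)]
    rw [holds_imp, holds_imp, holds_lt, holds_lt, h'.value_sRankExpr f8 f9, value_boundExpr f8,
      h'.value_cRankExpr f9 f8, h'.value_cNoneExpr f9, f6, holds_atLeast h'.nA,
      h'.value_quotaExpr f9]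
    have : ∀ a' : Fin I.nA, (Formula.eq (sRankExpr 10 9) (boundExpr 10)).Holds (s'.put 10 0 a') ↔
        I.sRank a' b = s 6 a' := fun a' => by
      have g : I.Ready (s'.put 10 0 a') := h'.put (by omega) _ _
      have g10 : s'.put 10 0 a' 10 0 = a' := by simp [Store.put_same]
      rw [holds_eq, g.value_sRankExpr g10 (by rw [Store.put_of_ne _ _ _ (by omega), f9]),
        value_boundExpr g10, Store.put_of_ne _ _ _ (by omega), f6]
    simp only [this]

/-- Scratch space starts at array `13`, beyond the input, the positions, the bounds and all
variables, so deciding the formula disturbs none of them. -/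
theorem below_advanceFormula : advanceFormula.Below 13 := by
  simp [advanceFormula, rejectsFormula, sibFormula, Formula.Below, Expr.Below, Formula.ex,
    Formula.disj, Formula.eq, Formula.le, sRankExpr, sNoneExpr, cRankExpr, cNoneExpr, quotaExpr,
    activityExpr, boundExpr, var]

theorem below_acceptingFormula : acceptingFormula.Below 13 := by
  simp [acceptingFormula, sibFormula, Formula.Below, Expr.Below, Formula.ex, Formula.all,
    Formula.imp, Formula.disj, Formula.eq, Formula.le, sRankExpr, sNoneExpr, cRankExpr, cNoneExpr,
    quotaExpr, boundExpr, var]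

end MSSPInstance

namespace MSSPInstance

open RAM

variable {I : MSSPInstance}

/-! ### Running the program -/

/-- The machine cannot multiply, so multiples of the row length are produced by repeated addition.
`P` carries along what earlier stages established; array `7` is the loop counter. Cell `n` is filled
too, since it is the start of the next block. -/
theorem triple_fillProgram {P : Store → Prop} {x n d c N : ℕ} {b e : Expr} (hx : x ≠ 7)
    (hP : ∀ s, P s → b.value s = n ∧ e.value s = d)
    (h7 : ∀ s i, P s → P (s.put 7 0 i)) (hPx : ∀ s i m, P s → P (s.put x i m)) (hn : n ≤ N) :
    Triple (fun s => P s ∧ s x 0 = c) (fillProgram x b e)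
      ((N + 1) * (e.cost + 9 + b.cost + 10) + 3) (fun s => P s ∧ ∀ i ≤ n, s x i = c + i * d) := by
  refine (Triple.forLoop
    (inv := fun i s => P s ∧ s 7 0 = i ∧ ∀ j ≤ i, s x j = c + j * d) hn
    (fun i s h => (hP s h.1).1) (fun i s h => h.2.1) ?_).conseq ?_ le_rfl ?_
  · intro i hi
    refine (Triple.write _ _ _ ?_).conseq (fun _ h => h) ?_ (fun _ h => h)
    · rintro s ⟨h1, h2, h3⟩
      simp only [Expr.value, value_var, h2, h3 i le_rfl, (hP s h1).2]
      refine ⟨?_, h7 _ _ (hPx _ _ _ h1), by simp [Store.put_same], fun j hj => ?_⟩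
      · rw [Store.put_of_ne _ _ _ (by omega), h2]
      · rw [Store.put_of_ne _ _ _ (by omega), Store.put_same]
        by_cases hji : j = i + 1
        · subst hji
          rw [Function.update_self]; ring
        · rw [Function.update_of_ne hji, h3 j (by omega)]
    · simp only [Expr.cost, var]; omega
  · rintro s ⟨h1, h2⟩
    refine ⟨h7 _ _ h1, by simp [Store.put_same], fun j hj => ?_⟩
    rw [Store.put_of_ne _ _ _ (by omega), Nat.le_zero.1 hj, h2]
    simp
  · rintro s ⟨h1, -, h2⟩
    exact ⟨h1, h2⟩

theorem triple_initProgram {N : ℕ} (hA : I.nA ≤ N) (hB : I.nB ≤ N) :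
    Triple (fun s => s = input I.encode) initProgram ((N + 1) * 75 + 50)
      (fun s => I.Ready s ∧ s 6 = fun _ => 0) := by
  let P : Store → Prop := fun s =>
    s 0 = I.entry ∧ s 1 0 = I.encode.length ∧ s 6 = fun _ => 0
  let P₁ : Store → Prop := fun s => P s ∧ ∀ i ≤ I.nA, s 3 i = I.studentPos i
  let P₂ : Store → Prop := fun s => P₁ s ∧ ∀ i ≤ I.nB, s 4 i = I.classPos i
  have hP : ∀ x, x ≠ 0 → x ≠ 1 → x ≠ 6 → ∀ s i m, P s → P (s.put x i m) := by
    rintro x h0 h1 h6 s i m ⟨e1, e2, e3⟩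
    refine ⟨?_, ?_, ?_⟩ <;> rw [Store.put_of_ne _ _ _ (by omega)] <;> assumption
  have hP₁ : ∀ x, x ≠ 0 → x ≠ 1 → x ≠ 6 → x ≠ 3 → ∀ s i m, P₁ s → P₁ (s.put x i m) := by
    rintro x h0 h1 h6 h3 s i m ⟨e1, e2⟩
    refine ⟨hP x h0 h1 h6 s i m e1, ?_⟩
    rw [Store.put_of_ne _ _ _ (by omega)]; exact e2
  have hP₂ : ∀ x, x ≠ 0 → x ≠ 1 → x ≠ 6 → x ≠ 3 → x ≠ 4 →
      ∀ s i m, P₂ s → P₂ (s.put x i m) := by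
    rintro x h0 h1 h6 h3 h4 s i m ⟨e1, e2⟩
    refine ⟨hP₁ x h0 h1 h6 h3 s i m e1, ?_⟩
    rw [Store.put_of_ne _ _ _ (by omega)]; exact e2
  have hA0 : ∀ s, P s → s 0 0 = I.nA := fun s h => by rw [h.1, I.entry_zero]
  have hB0 : ∀ s, P s → s 0 1 = I.nB := fun s h => by rw [h.1, I.entry_one]
  have f1 := triple_fillProgram (P := P) (x := 3) (n := I.nA) (d := I.nB + 1) (c := 3) (N := N)
    (b := .read 0 (.num 0)) (e := .add (.read 0 (.num 1)) (.num 1)) (by omega)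
    (fun s h => ⟨hA0 s h, by simp only [Expr.value, hB0 s h]⟩)
    (fun s i => hP 7 (by omega) (by omega) (by omega) s 0 i)
    (hP 3 (by omega) (by omega) (by omega)) hA
  have f2 := triple_fillProgram (P := P₁) (x := 4) (n := I.nB) (d := I.nA + 1)
    (c := I.studentPos I.nA) (N := N)
    (b := .read 0 (.num 1)) (e := .add (.read 0 (.num 0)) (.num 1)) (by omega)
    (fun s h => ⟨hB0 s h.1, by simp only [Expr.value, hA0 s h.1]⟩)
    (fun s i => hP₁ 7 (by omega) (by omega) (by omega) (by omega) s 0 i)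
    (hP₁ 4 (by omega) (by omega) (by omega) (by omega)) hB
  have f3 := triple_fillProgram (P := P₂) (x := 5) (n := I.nA) (d := I.nA)
    (c := I.classPos I.nB + I.nB + I.nB) (N := N)
    (b := .read 0 (.num 0)) (e := .read 0 (.num 0)) (by omega)
    (fun s h => ⟨hA0 s h.1.1, by simp only [Expr.value, hA0 s h.1.1]⟩)
    (fun s i => hP₂ 7 (by omega) (by omega) (by omega) (by omega) (by omega) s 0 i)
    (hP₂ 5 (by omega) (by omega) (by omega) (by omega) (by omega)) hA
  refine ((((((Triple.write _ _ _ ?_).seq f1).seq (Triple.write _ _ _ ?_)).seq f2).seq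
    (Triple.write _ _ _ ?_)).seq f3).conseq (fun _ h => h) ?_ ?_
  · rintro s rfl
    refine ⟨hP 3 (by omega) (by omega) (by omega) _ _ _ ⟨?_, ?_, ?_⟩, ?_⟩
    · funext i; simp [input, entry]
    · simp [input]
    · funext i; simp [input]
    · simp [Store.put_same, Expr.value]
  · rintro s ⟨h1, h2⟩
    refine ⟨hP₁ 4 (by omega) (by omega) (by omega) (by omega) _ _ _ ⟨h1, h2⟩, ?_⟩
    simp only [Expr.value, Store.put_same, Function.update_self, hA0 s h1, h2 I.nA le_rfl]
    rfl
  · rintro s ⟨h1, h2⟩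
    refine ⟨hP₂ 5 (by omega) (by omega) (by omega) (by omega) (by omega) _ _ _ ⟨h1, h2⟩, ?_⟩
    simp only [Expr.value, Store.put_same, Function.update_self, hB0 s h1.1, h2 I.nB le_rfl]
    rfl
  · simp only [Expr.cost]; omega
  · rintro s ⟨⟨⟨⟨h1, h2, h3⟩, h4⟩, h5⟩, h6⟩
    exact ⟨⟨h1, h2, h4, h5, h6⟩, h3⟩

/-! ### Progress of the lower bounds -/

variable (I) in
/-- The state of the lower bounds when `i` students have been treated in round `n`. -/
structure Progress (n i : ℕ) (R : ℕ → ℕ) : Prop where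
  lowerBound : ∀ M, I.IsActivityStable M → I.LowerBound R M
  le : ∀ a : Fin I.nA, R a ≤ I.nB + 1
  sum : (∀ a, ¬ I.CanAdvance R a) ∨ n + 1 ≤ ∑ a : Fin I.nA, R a ∨
    (n ≤ ∑ a : Fin I.nA, R a ∧ ∀ a : Fin I.nA, (a : ℕ) < i → ¬ I.CanAdvance R a)

theorem Progress.zero : I.Progress 0 0 fun _ => 0 where
  lowerBound _ _ _ := Nat.zero_le _
  le _ := Nat.zero_le _
  sum := .inr (.inr ⟨Nat.zero_le _, fun _ h => absurd h (Nat.not_lt_zero _)⟩)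

/-- A complete round either has raised the sum or has found every student unable to advance under
the same bounds, which is a fixed point. -/
theorem Progress.round {n : ℕ} {R : ℕ → ℕ} (h : I.Progress n I.nA R) : I.Progress (n + 1) 0 R where
  lowerBound := h.lowerBound
  le := h.le
  sum := by
    rcases h.sum with h | h | ⟨-, h⟩
    · exact .inl h
    · exact .inr (.inr ⟨h, fun _ h => absurd h (Nat.not_lt_zero _)⟩)
    · exact .inl fun a => h a a.isLt

theorem Progress.stay {n : ℕ} {R : ℕ → ℕ} {a : Fin I.nA} (h : I.Progress n a R)
    (ha : ¬ I.CanAdvance R a) : I.Progress n (a + 1) R where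
  lowerBound := h.lowerBound
  le := h.le
  sum := by
    rcases h.sum with h | h | ⟨h, h'⟩
    · exact .inl h
    · exact .inr (.inl h)
    · refine .inr (.inr ⟨h, fun a' ha' => ?_⟩)
      rcases Nat.lt_succ_iff_lt_or_eq.1 ha' with h1 | h1
      · exact h' a' h1
      · rwa [Fin.ext h1]

/-- One increase is enough for the whole round. It may allow earlier students to advance again, so
what was known about them is given up for the larger sum. -/
theorem Progress.advance {n : ℕ} {R : ℕ → ℕ} {a : Fin I.nA} (h : I.Progress n a R)
    (ha : I.CanAdvance R a) : I.Progress n (a + 1) (Function.update R a (R a + 1)) where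
  lowerBound M hM := (h.lowerBound M hM).advance hM ha
  le a' := by
    by_cases haa : (a' : ℕ) = a
    · obtain ⟨b, hb, -⟩ := ha
      -- A bound grows only from the rank of a class, which is at most `nB`.
      have : I.sRank a b < I.nB + 1 := (I.studentRank a (some b)).isLt
      rw [haa, Function.update_self]
      omega
    · rw [Function.update_of_ne haa]
      exact h.le a'
  sum := by
    have hlt : ∑ a' : Fin I.nA, R a' < ∑ a' : Fin I.nA, Function.update R a (R a + 1) a' := by
      refine Finset.sum_lt_sum (fun a' _ => ?_) ⟨a, Finset.mem_univ _, by simp⟩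
      by_cases haa : (a' : ℕ) = a
      · rw [haa, Function.update_self]; omega
      · rw [Function.update_of_ne haa]
    rcases h.sum with h | h | ⟨h, -⟩
    · exact absurd ha (h a)
    · exact .inr (.inl (by omega))
    · exact .inr (.inl (by omega))

/-- After more rounds than the sum of the bounds permits increases, only the alternative of a fixed
point is left. -/
theorem Progress.fixed {n i : ℕ} {R : ℕ → ℕ} (h : I.Progress n i R)
    (hn : I.nA * (I.nB + 1) < n) (a : Fin I.nA) : ¬ I.CanAdvance R a := by
  have h1 : ∑ a : Fin I.nA, R a ≤ I.nA * (I.nB + 1) := by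
    simpa using Finset.sum_le_card_nsmul Finset.univ (fun a : Fin I.nA => R a) _ fun a _ => h.le a
  rcases h.sum with h | h | ⟨h, -⟩
  · exact h a
  · omega
  · omega

/-! ### Correctness and running time of the whole program -/

theorem triple_advanceProgram {N : ℕ} (hA : I.nA ≤ N) (hB : I.nB ≤ N) (n : ℕ) (a : Fin I.nA) :
    Triple (fun s => I.Ready s ∧ s 7 0 = n ∧ s 8 0 = a ∧ I.Progress n a (s 6)) advanceProgram
      (advanceFormula.cost.eval N + 13)
      (fun s => I.Ready s ∧ s 7 0 = n ∧ s 8 0 = a ∧ I.Progress n (a + 1) (s 6)) := by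
  classical
  refine Triple.pointwise fun s₀ ⟨h1, h2, h3, h4⟩ => ?_
  have hN : ∀ j < 2, s₀ 0 j ≤ N := by
    intro j hj
    interval_cases j
    · rw [h1.nA]; exact hA
    · rw [h1.nB]; exact hB
  have hf := advanceFormula.triple_compile 13 N s₀ below_advanceFormula hN (by omega)
  refine (hf.seq (Triple.cond (Triple.write _ _ _ ?_)
    ((Triple.skip _).conseq (fun _ h => h) le_rfl ?_))).conseq ?_ ?_ (fun _ h => h)
  · rintro s ⟨⟨hs, hr⟩, hne⟩
    have hadv : I.CanAdvance (s₀ 6) a := by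
      rw [value_var, hr] at hne
      rw [← h1.holds_advanceFormula h3]
      by_contra hn
      rw [if_neg hn] at hne
      exact hne rfl
    have hs' : I.Ready s := h1.congr fun x hx => hs x (by omega)
    simp only [Expr.value, value_var, hs 6 (by omega), hs 8 (by omega), h3]
    refine ⟨hs'.put le_rfl _ _, ?_, ?_, ?_⟩
    · rw [Store.put_of_ne _ _ _ (by omega), hs 7 (by omega), h2]
    · rw [Store.put_of_ne _ _ _ (by omega), hs 8 (by omega), h3]
    · rw [Store.put_same, hs 6 (by omega)]
      exact h4.advance hadv
  · rintro s ⟨⟨hs, hr⟩, hne⟩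
    have hadv : ¬ I.CanAdvance (s₀ 6) a := by
      rw [value_var, hr] at hne
      rw [← h1.holds_advanceFormula h3]
      by_contra hn
      rw [if_pos hn] at hne
      exact one_ne_zero hne
    refine ⟨h1.congr fun x hx => hs x (by omega), ?_, ?_, ?_⟩
    · rw [hs 7 (by omega), h2]
    · rw [hs 8 (by omega), h3]
    · rw [hs 6 (by omega)]
      exact h4.stay hadv
  · rintro s rfl x _; rfl
  · simp only [Expr.cost, var]; omega

theorem triple_fixProgram {N : ℕ} (hN : I.encode.length ≤ N) :
    Triple (fun s => I.Ready s ∧ s 6 = fun _ => 0) fixProgram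
      ((N + 1) * ((N + 1) * (advanceFormula.cost.eval N + 25) + 15) + 3)
      (fun s => I.Ready s ∧ I.Progress I.encode.length 0 (s 6)) := by
  have hA := I.nA_le_length_encode.trans hN
  have hB := I.nB_le_length_encode.trans hN
  have inner : ∀ n, Triple (fun s => I.Ready s ∧ s 7 0 = n ∧ I.Progress n 0 (s 6))
      (forLoop 8 (.read 0 (.num 0)) advanceProgram)
      ((N + 1) * (advanceFormula.cost.eval N + 25) + 3)
      (fun s => I.Ready s ∧ s 7 0 = n ∧ I.Progress n I.nA (s 6)) := by
    intro n
    refine (Triple.forLoop (n := I.nA) (b := .read 0 (.num 0))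
      (T := advanceFormula.cost.eval N + 13)
      (inv := fun i s => I.Ready s ∧ s 7 0 = n ∧ s 8 0 = i ∧ I.Progress n i (s 6)) hA
      (fun i s h => h.1.nA) (fun i s h => h.2.2.1) ?_).conseq ?_ (le_of_eq ?_) ?_
    · intro i hi
      refine (triple_advanceProgram hA hB n ⟨i, hi⟩).conseq (fun _ h => h) le_rfl ?_
      rintro s ⟨h1, h2, h3, h4⟩
      refine ⟨h3, h1.put (by omega) _ _, ?_, by simp [Store.put_same], ?_⟩
      · rw [Store.put_of_ne _ _ _ (by omega), h2]
      · rw [Store.put_of_ne _ _ _ (by omega)]; exact h4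
    · rintro s ⟨h1, h2, h3⟩
      refine ⟨h1.put (by omega) _ _, ?_, by simp [Store.put_same], ?_⟩
      · rw [Store.put_of_ne _ _ _ (by omega), h2]
      · rw [Store.put_of_ne _ _ _ (by omega)]; exact h3
    · simp only [Expr.cost]
    · rintro s ⟨h1, h2, -, h3⟩
      exact ⟨h1, h2, h3⟩
  refine (Triple.forLoop (n := I.encode.length) (b := .read 1 (.num 0))
    (T := (N + 1) * (advanceFormula.cost.eval N + 25) + 3)
    (inv := fun i s => I.Ready s ∧ s 7 0 = i ∧ I.Progress i 0 (s 6)) hN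
    (fun i s h => h.1.length) (fun i s h => h.2.1) ?_).conseq ?_ (le_of_eq ?_) ?_
  · intro i hi
    refine (inner i).conseq (fun _ h => h) le_rfl ?_
    rintro s ⟨h1, h2, h3⟩
    refine ⟨h2, h1.put (by omega) _ _, by simp [Store.put_same], ?_⟩
    rw [Store.put_of_ne _ _ _ (by omega)]
    exact h3.round
  · rintro s ⟨h1, h2⟩
    refine ⟨h1.put (by omega) _ _, by simp [Store.put_same], ?_⟩
    rw [Store.put_of_ne _ _ _ (by omega), h2]
    exact Progress.zero
  · simp only [Expr.cost]
  · rintro s ⟨h1, -, h2⟩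
    exact ⟨h1, h2⟩

open Classical in
theorem triple_msspProgram {N : ℕ} (hN : I.encode.length ≤ N) :
    Triple (fun s => s = input I.encode) msspProgram
      ((N + 1) * 75 + 50 + ((N + 1) * ((N + 1) * (advanceFormula.cost.eval N + 25) + 15) + 3) +
        acceptingFormula.cost.eval N + 4)
      (fun s => output s = if ∃ M, I.IsActivityStable M then 1 else 0) := by
  have hA := I.nA_le_length_encode.trans hN
  have hB := I.nB_le_length_encode.trans hN
  have hacc : Triple (fun s => I.Ready s ∧ I.Progress I.encode.length 0 (s 6))
      (acceptingFormula.compile 13) (acceptingFormula.cost.eval N)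
      (fun s => s 13 0 = if ∃ M, I.IsActivityStable M then 1 else 0) := by
    refine Triple.pointwise fun s₀ ⟨h1, h2⟩ => ?_
    have hN : ∀ j < 2, s₀ 0 j ≤ N := by
      intro j hj
      interval_cases j
      · rw [h1.nA]; exact hA
      · rw [h1.nB]; exact hB
    refine (acceptingFormula.triple_compile 13 N s₀ below_acceptingFormula hN (by omega)).conseq
      ?_ le_rfl ?_
    · rintro s rfl x _; rfl
    · rintro s ⟨-, hs⟩
      -- At this fixed point the test is both sufficient and necessary for an activity-stable
      -- matching.
      have hfix := h2.fixed I.lt_length_encode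
      have hiff : acceptingFormula.Holds s₀ ↔ ∃ M, I.IsActivityStable M := by
        rw [h1.holds_acceptingFormula]
        exact ⟨fun h => h.exists_isActivityStable hfix,
          fun ⟨M, hM⟩ => (h2.lowerBound M hM).accepting hM hfix⟩
      rw [hs]
      simp only [hiff]
  refine ((((triple_initProgram hA hB).seq (triple_fixProgram hN)).seq hacc).seq
    (Triple.write _ _ _ ?_)).conseq (fun _ h => h) ?_ (fun _ h => h)
  · intro s hs
    simp only [output, Expr.value, value_var, Store.put_same, Function.update_self, hs]
  · simp only [Expr.cost, var]; omega

end MSSPInstance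

/-- It can be decided in polynomial time whether an instance of (MSSP) has an activity-stable
matching. -/
theorem mainTheorem5 :
    RAM.SolvableInPolyTime MSSPInstance.encode
      (fun I : MSSPInstance => ∃ M : Fin I.nA → Option (Fin I.nB), I.IsActivityStable M) := by
  classical
  refine ⟨RAM.msspProgram, (Polynomial.X + 1) * 75 + 50 + ((Polynomial.X + 1) *
    ((Polynomial.X + 1) * (RAM.advanceFormula.cost + 25) + 15) + 3) +
    RAM.acceptingFormula.cost + 4, fun I => ?_⟩
  -- The time bound is taken with `N` equal to the bit size, which is at least the number of entries
  -- of the input because every entry counts at least one bit.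
  obtain ⟨t, s, h1, h2, h3⟩ := MSSPInstance.triple_msspProgram
    (MSSPInstance.length_le_bitSize I.encode) _ rfl
  refine ⟨t, s, h1, h2.trans (le_of_eq ?_), fun h => ?_, fun h => ?_⟩
  · simp only [Polynomial.eval_add, Polynomial.eval_mul, Polynomial.eval_X, Polynomial.eval_one,
      Polynomial.eval_ofNat]
  · rw [h3, if_pos h]
  · rw [h3, if_neg h]
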